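/- Let $k$ be an algebraically closed field of characteristic zero, let $\alpha\in k^\times$, and let $a\in k[z]$ be a polynomial of degree $n>2$. Let $R=k[z][x,y;\sigma,a]$, with $\sigma(z)=z-\alpha$, be the corresponding classical generalized Weyl algebra, i.e. the $k$-algebra generated over $k[z]$ by $x$ and $y$ subject to $xy=\sigma(a)$, $yx=a$, $xd=\sigma(d)x$ and $yd=\sigma^{-1}(d)y$ for all $d\in k[z]$. Equip $R$ with the standard filtration $(F_i)_{i\ge 0}$ determined by $\deg x=\deg y=n$ and $\deg z=2$ (so $F_i$ is spanned by the words in $x,y,z$ of total degree at most $i$), and let $\mathrm{Aut}_f(R)$ be the group of filtered automorphisms of $R$: the $k$-algebra automorphisms $\phi$ with $\deg\phi(r)=\deg r$ for all $r\in R$. For $\lambda\in k^\times$ let $\Theta_\lambda$ be the automorphism $x\mapsto\lambda x$, $y\mapsto\lambda^{-1}y$, $z\mapsto z$. Call $a$ reflective if there is $\rho\in k$ with $a(\rho-z)=(-1)^n a(z)$; in that case let $\Omega$ be the automorphism $x\mapsto y$, $y\mapsto(-1)^n x$, $z\mapsto\alpha+\rho-z$. 1. If $a$ is not reflective, then $\mathrm{Aut}_f(R)$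 is generated by the maps $\Theta_\lambda$, $\lambda\in k^\times$. 2. If $a$ is reflective, then $\mathrm{Aut}_f(R)$ is generated by $\Omega$ and the maps $\Theta_\lambda$, $\lambda\in k^\times$. 3. Every $g\in\mathrm{Aut}_f(R)$ has homological determinant $1$. Here the homological determinant of $g$ is that of the induced graded automorphism $\mathrm{gr}\,g$ of the associated graded algebra $\mathrm{gr}\,R=\bigoplus_i F_i/F_{i-1}$. For a graded automorphism $h$ of a connected graded Artin–Schelter Gorenstein algebra $A$ of injective dimension $d$, one has $\mathrm{Ext}^i_A(k,A)=0$ for $i\ne d$ and $\dim_k\mathrm{Ext}^d_A(k,A)=1$, and the homological determinant of $h$ is the scalar $c\in k^\times$ such that $h$ acts on $\mathrm{Ext}^d_A(k,A)$, by transport of structure, as multiplication by $c^{-1}$. -/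

import Mathlib

open Polynomial DirectSum CategoryTheory

/-! ### Generalized Weyl algebras -/

section GWA

universe u v

/-- The generators of the generalized Weyl algebra `D[x, y; σ, a]`: the elements of `D`, and the
two new variables `x` and `y`. -/
inductive GWAGen (D : Type v) : Type v
  | coeff (d : D)
  | x
  | y

variable (k : Type u) [CommRing k] {D : Type v} [Ring D] [Algebra k D]

open GWAGen in
/-- The defining relations of `D[x, y; σ, a]`. The first three say that `D` is mapped to the
quotient by a homomorphism of `k`-algebras; the other four are
`x y = σ(a)`, `y x = a`, `x d = σ(d) x`, `y d = σ⁻¹(d) y`. -/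
inductive GWARel (σ : D ≃ₐ[k] D) (a : D) :
    FreeAlgebra k (GWAGen D) → FreeAlgebra k (GWAGen D) → Prop
  | coeff_add (d e : D) : GWARel σ a (FreeAlgebra.ι k (coeff (d + e)))
      (FreeAlgebra.ι k (coeff d) + FreeAlgebra.ι k (coeff e))
  | coeff_mul (d e : D) : GWARel σ a (FreeAlgebra.ι k (coeff (d * e)))
      (FreeAlgebra.ι k (coeff d) * FreeAlgebra.ι k (coeff e))
  | coeff_algebraMap (r : k) : GWARel σ a (FreeAlgebra.ι k (coeff (algebraMap k D r)))
      (algebraMap k (FreeAlgebra k (GWAGen D)) r)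
  | x_mul_y : GWARel σ a (FreeAlgebra.ι k x * FreeAlgebra.ι k y) (FreeAlgebra.ι k (coeff (σ a)))
  | y_mul_x : GWARel σ a (FreeAlgebra.ι k y * FreeAlgebra.ι k x) (FreeAlgebra.ι k (coeff a))
  | x_mul_coeff (d : D) : GWARel σ a (FreeAlgebra.ι k x * FreeAlgebra.ι k (coeff d))
      (FreeAlgebra.ι k (coeff (σ d)) * FreeAlgebra.ι k x)
  | y_mul_coeff (d : D) : GWARel σ a (FreeAlgebra.ι k y * FreeAlgebra.ι k (coeff d))
      (FreeAlgebra.ι k (coeff (σ.symm d)) * FreeAlgebra.ι k y)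

/-- The generalized Weyl algebra (of degree one) `D[x, y; σ, a]` of a `k`-algebra `D`, an
automorphism `σ` of `D` and a (central) element `a` of `D`. -/
def GWA (σ : D ≃ₐ[k] D) (a : D) : Type (max u v) := RingQuot (GWARel k σ a)

namespace GWA

variable {k} (σ : D ≃ₐ[k] D) (a : D)

noncomputable instance : Ring (GWA k σ a) := inferInstanceAs (Ring (RingQuot (GWARel k σ a)))

noncomputable instance : Algebra k (GWA k σ a) :=
  inferInstanceAs (Algebra k (RingQuot (GWARel k σ a)))

/-- The projection from the free algebra. -/
noncomputable def proj : FreeAlgebra k (GWAGen D) →ₐ[k] GWA k σ a :=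
  RingQuot.mkAlgHom k (GWARel k σ a)

theorem proj_rel {p q : FreeAlgebra k (GWAGen D)} (h : GWARel k σ a p q) :
    proj σ a p = proj σ a q :=
  RingQuot.mkAlgHom_rel k h

/-- The element `x` of `D[x, y; σ, a]`. -/
noncomputable def x : GWA k σ a := proj σ a (FreeAlgebra.ι k GWAGen.x)

/-- The element `y` of `D[x, y; σ, a]`. -/
noncomputable def y : GWA k σ a := proj σ a (FreeAlgebra.ι k GWAGen.y)

/-- The canonical map `D → D[x, y; σ, a]`. -/
noncomputable def coeff : D →ₐ[k] GWA k σ a where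
  toFun d := proj σ a (FreeAlgebra.ι k (GWAGen.coeff d))
  map_one' := by
    have := proj_rel σ a (GWARel.coeff_algebraMap (1 : k))
    simpa using this
  map_mul' d e := by simpa using proj_rel σ a (GWARel.coeff_mul d e)
  map_zero' := by
    have := proj_rel σ a (GWARel.coeff_algebraMap (0 : k))
    simpa using this
  map_add' d e := by simpa using proj_rel σ a (GWARel.coeff_add d e)
  commutes' r := by simpa using proj_rel σ a (GWARel.coeff_algebraMap r)

theorem x_mul_y : x σ a * y σ a = coeff σ a (σ a) :=
  (map_mul _ _ _).symm.trans (proj_rel σ a GWARel.x_mul_y)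

theorem y_mul_x : y σ a * x σ a = coeff σ a a :=
  (map_mul _ _ _).symm.trans (proj_rel σ a GWARel.y_mul_x)

theorem x_mul_coeff (d : D) : x σ a * coeff σ a d = coeff σ a (σ d) * x σ a :=
  (map_mul _ _ _).symm.trans ((proj_rel σ a (GWARel.x_mul_coeff d)).trans (map_mul _ _ _))

theorem y_mul_coeff (d : D) : y σ a * coeff σ a d = coeff σ a (σ.symm d) * y σ a :=
  (map_mul _ _ _).symm.trans ((proj_rel σ a (GWARel.y_mul_coeff d)).trans (map_mul _ _ _))

variable {σ a} {B : Type*} [Ring B] [Algebra k B]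

/-- The universal property of `D[x, y; σ, a]`. -/
noncomputable def lift (f : D →ₐ[k] B) (X Y : B) (hxy : X * Y = f (σ a)) (hyx : Y * X = f a)
    (hx : ∀ d, X * f d = f (σ d) * X) (hy : ∀ d, Y * f d = f (σ.symm d) * Y) :
    GWA k σ a →ₐ[k] B :=
  RingQuot.liftAlgHom k ⟨FreeAlgebra.lift k (fun g => match g with
    | GWAGen.coeff d => f d
    | GWAGen.x => X
    | GWAGen.y => Y), by
      intro p q h
      induction h <;> simp_all⟩

theorem lift_proj (f : D →ₐ[k] B) (X Y : B) (hxy : X * Y = f (σ a)) (hyx : Y * X = f a)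
    (hx : ∀ d, X * f d = f (σ d) * X) (hy : ∀ d, Y * f d = f (σ.symm d) * Y)
    (p : FreeAlgebra k (GWAGen D)) :
    lift f X Y hxy hyx hx hy (proj σ a p) = FreeAlgebra.lift k (fun g => match g with
      | GWAGen.coeff d => f d
      | GWAGen.x => X
      | GWAGen.y => Y) p :=
  RingQuot.liftAlgHom_mkAlgHom_apply k _ _ p

section

variable (f : D →ₐ[k] B) (X Y : B) (hxy : X * Y = f (σ a)) (hyx : Y * X = f a)
    (hx : ∀ d, X * f d = f (σ d) * X) (hy : ∀ d, Y * f d = f (σ.symm d) * Y)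

@[simp] theorem lift_x : lift f X Y hxy hyx hx hy (x σ a) = X := by
  rw [x, lift_proj]; simp

@[simp] theorem lift_y : lift f X Y hxy hyx hx hy (y σ a) = Y := by
  rw [y, lift_proj]; simp

@[simp] theorem lift_coeff (d : D) : lift f X Y hxy hyx hx hy (coeff σ a d) = f d := by
  change lift f X Y hxy hyx hx hy (proj σ a _) = _
  rw [lift_proj]; simp

end

theorem algHom_ext {f g : GWA k σ a →ₐ[k] B} (hc : ∀ d, f (coeff σ a d) = g (coeff σ a d))
    (hx : f (x σ a) = g (x σ a)) (hy : f (y σ a) = g (y σ a)) : f = g := by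
  refine RingQuot.ringQuot_ext' k (s := GWARel k σ a) f g
    (FreeAlgebra.hom_ext (funext fun i => ?_))
  cases i with
  | coeff d => exact hc d
  | x => exact hx
  | y => exact hy

variable (σ a)

/-- The endomorphism `x ↦ c x`, `y ↦ c⁻¹ y`, `d ↦ d`. -/
noncomputable def ThetaHom (c : kˣ) : GWA k σ a →ₐ[k] GWA k σ a :=
  lift (coeff σ a) ((c : k) • x σ a) (((c⁻¹ : kˣ) : k) • y σ a)
    (by simp [smul_smul, x_mul_y]) (by simp [smul_smul, y_mul_x])
    (fun d => by simp [x_mul_coeff]) (fun d => by simp [y_mul_coeff])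

theorem ThetaHom_comp (c d : kˣ) (h : d * c = 1) :
    (ThetaHom σ a c).comp (ThetaHom σ a d) = AlgHom.id k _ := by
  obtain rfl : d = c⁻¹ := eq_inv_of_mul_eq_one_left h
  apply algHom_ext <;> simp [ThetaHom, smul_smul]

/-- The automorphism `Θ_c : x ↦ c x, y ↦ c⁻¹ y, d ↦ d` of `D[x, y; σ, a]`. -/
noncomputable def Theta (c : kˣ) : GWA k σ a ≃ₐ[k] GWA k σ a :=
  AlgEquiv.ofAlgHom (ThetaHom σ a c) (ThetaHom σ a c⁻¹)
    (ThetaHom_comp σ a _ _ (by simp)) (ThetaHom_comp σ a _ _ (by simp))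

end GWA

end GWA

/-! ### Filtered algebras, filtered automorphisms and associated graded algebras -/

section Filtered

universe u v

variable {k : Type u} [Field k] {R : Type v} [Ring R] [Algebra k R]

/-- `F_{<i} = ∑_{j < i} F_j`, which is `F_{i-1}` for an increasing `F` and `i > 0`,
and `0` for `i = 0`. -/
def filtLT (F : ℕ → Submodule k R) (i : ℕ) : Submodule k R := ⨆ j, ⨆ _ : j < i, F j

variable (F : ℕ → Submodule k R)

/-- The group of filtered automorphisms of the filtered algebra `R = ⋃ F_i`: the automorphisms of
the `k`-algebra `R` that preserve the degree of every element, where `deg r ≤ i` means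
`r ∈ F_i`. -/
def filteredAut : Subgroup (R ≃ₐ[k] R) where
  carrier := {g | ∀ (i : ℕ) (r : R), g r ∈ F i ↔ r ∈ F i}
  one_mem' := fun _ _ => Iff.rfl
  mul_mem' := fun {g h} hg hh i r => (hg i (h r)).trans (hh i r)
  inv_mem' := fun {g} hg i r => by
    have := hg i (g⁻¹ r)
    rw [show g (g⁻¹ r) = r from g.apply_symm_apply r] at this
    exact this.symm

/-- The component `F_i / F_{<i}` of the associated graded algebra. -/
def grPiece (i : ℕ) : Type v := F i ⧸ (filtLT F i).submoduleOf (F i)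

instance (i : ℕ) : AddCommGroup (grPiece F i) :=
  inferInstanceAs (AddCommGroup (F i ⧸ (filtLT F i).submoduleOf (F i)))

instance (i : ℕ) : Module k (grPiece F i) :=
  inferInstanceAs (Module k (F i ⧸ (filtLT F i).submoduleOf (F i)))

/-- The class (principal symbol) of `r ∈ F_i` in `F_i / F_{<i}`. -/
def grMk (i : ℕ) : F i →ₗ[k] grPiece F i := ((filtLT F i).submoduleOf (F i)).mkQ

variable {F}

theorem grMk_eq_zero {i : ℕ} (r : F i) : grMk F i r = 0 ↔ (r : R) ∈ filtLT F i :=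
  Submodule.Quotient.mk_eq_zero _

theorem grMk_surjective (i : ℕ) : Function.Surjective (grMk F i) := Submodule.mkQ_surjective _

theorem filtLT_map {f : R →ₗ[k] R} (hf : ∀ (i : ℕ) (r : R), r ∈ F i → f r ∈ F i) {i : ℕ} {r : R}
    (hr : r ∈ filtLT F i) : f r ∈ filtLT F i := by
  suffices filtLT F i ≤ (filtLT F i).comap f from this hr
  refine iSup₂_le fun j hj r hr => ?_
  exact (le_iSup₂_of_le (f := fun j (_ : j < i) => F j) j hj le_rfl) (hf j r hr)

theorem gr_sigma_ext {i j : ℕ} (h : i = j) (r : F i) (s : F j) (hrs : (r : R) = s) :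
    (GradedMonoid.mk i (grMk F i r) : GradedMonoid (grPiece F)) =
      GradedMonoid.mk j (grMk F j s) := by
  subst h
  obtain rfl : r = s := Subtype.ext hrs
  rfl

variable [IsRingFiltration F (filtLT F)]

theorem filtLT_mul_left {i j : ℕ} {r s : R} (hr : r ∈ filtLT F i) (hs : s ∈ F j) :
    r * s ∈ filtLT F (i + j) := by
  suffices filtLT F i ≤ (filtLT F (i + j)).comap (LinearMap.mulRight k s) from this hr
  refine iSup₂_le fun l hl r hr => ?_
  have h : r * s ∈ F (l + j) := SetLike.GradedMul.mul_mem hr hs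
  exact (le_iSup₂_of_le (f := fun m (_ : m < i + j) => F m) (l + j) (by omega) le_rfl) h

theorem filtLT_mul_right {i j : ℕ} {r s : R} (hr : r ∈ F i) (hs : s ∈ filtLT F j) :
    r * s ∈ filtLT F (i + j) := by
  suffices filtLT F j ≤ (filtLT F (i + j)).comap (LinearMap.mulLeft k r) from this hs
  refine iSup₂_le fun l hl s hs => ?_
  have h : r * s ∈ F (i + l) := SetLike.GradedMul.mul_mem hr hs
  exact (le_iSup₂_of_le (f := fun m (_ : m < i + j) => F m) (i + l) (by omega) le_rfl) h

/-- The multiplication `F_i × F_j → F_{i+j}`. -/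
def filtMul (i j : ℕ) : F i →ₗ[k] F j →ₗ[k] F (i + j) :=
  LinearMap.mk₂ k (fun r s => ⟨(r : R) * s, SetLike.GradedMul.mul_mem r.2 s.2⟩)
    (fun _ _ _ => Subtype.ext (add_mul _ _ _)) (fun _ _ _ => Subtype.ext (smul_mul_assoc _ _ _))
    (fun _ _ _ => Subtype.ext (mul_add _ _ _)) (fun _ _ _ => Subtype.ext (mul_smul_comm _ _ _))

/-- The multiplication `F_i / F_{<i} × F_j / F_{<j} → F_{i+j} / F_{<i+j}`. -/
def grMul (i j : ℕ) : grPiece F i →ₗ[k] grPiece F j →ₗ[k] grPiece F (i + j) :=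
  Submodule.liftQ _
    (LinearMap.flip (Submodule.liftQ _
      (LinearMap.flip ((filtMul i j).compr₂ (grMk F (i + j))))
      (fun s hs => LinearMap.ext fun r => (grMk_eq_zero _).2 (filtLT_mul_right r.2 hs))))
    (fun r hr => LinearMap.ext fun s => by
      obtain ⟨s, rfl⟩ := grMk_surjective _ s
      exact (grMk_eq_zero _).2 (filtLT_mul_left hr s.2))

theorem grMul_mk {i j : ℕ} (r : F i) (s : F j) :
    grMul i j (grMk F i r) (grMk F j s) =
      grMk F (i + j) ⟨(r : R) * s, SetLike.GradedMul.mul_mem r.2 s.2⟩ := rfl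

instance grGOne : GradedMonoid.GOne (grPiece F) where
  one := grMk F 0 ⟨1, SetLike.GradedOne.one_mem⟩

instance grGMul : GradedMonoid.GMul (grPiece F) where
  mul r s := grMul _ _ r s

instance grGRing : DirectSum.GRing (grPiece F) where
  __ := grGOne
  __ := grGMul
  mul_zero r := map_zero _
  zero_mul s := by change grMul _ _ 0 s = 0; simp
  mul_add r s t := map_add _ _ _
  add_mul r s t := by change grMul _ _ (r + s) t = grMul _ _ r t + grMul _ _ s t; simp
  one_mul := by
    rintro ⟨i, r⟩
    obtain ⟨r, rfl⟩ := grMk_surjective _ r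
    exact gr_sigma_ext (zero_add i) _ _ (one_mul _)
  mul_one := by
    rintro ⟨i, r⟩
    obtain ⟨r, rfl⟩ := grMk_surjective _ r
    exact gr_sigma_ext (add_zero i) _ _ (mul_one _)
  mul_assoc := by
    rintro ⟨i, r⟩ ⟨j, s⟩ ⟨l, t⟩
    obtain ⟨r, rfl⟩ := grMk_surjective _ r
    obtain ⟨s, rfl⟩ := grMk_surjective _ s
    obtain ⟨t, rfl⟩ := grMk_surjective _ t
    exact gr_sigma_ext (add_assoc i j l) _ _ (mul_assoc _ _ _)
  natCast n := n • grMk F 0 ⟨1, SetLike.GradedOne.one_mem⟩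
  natCast_zero := zero_smul _ _
  natCast_succ n := succ_nsmul _ _
  intCast n := n • grMk F 0 ⟨1, SetLike.GradedOne.one_mem⟩
  intCast_ofNat n := natCast_zsmul _ _
  intCast_negSucc_ofNat n := by
    rw [Int.negSucc_eq, neg_smul, ← natCast_zsmul]; simp

instance grGAlgebra : DirectSum.GAlgebra k (grPiece F) where
  toFun := (LinearMap.toSpanSingleton k _
    (grMk F 0 ⟨1, SetLike.GradedOne.one_mem⟩)).toAddMonoidHom
  map_one := one_smul k (grMk F 0 ⟨1, SetLike.GradedOne.one_mem⟩)
  map_mul c d := by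
    refine gr_sigma_ext (add_zero 0).symm ((c * d) • ⟨1, SetLike.GradedOne.one_mem⟩)
      ⟨_, SetLike.GradedMul.mul_mem (c • (⟨1, SetLike.GradedOne.one_mem⟩ : F 0)).2
        (d • (⟨1, SetLike.GradedOne.one_mem⟩ : F 0)).2⟩ ?_
    simp [smul_smul, mul_comm]
  commutes := by
    rintro c ⟨i, r⟩
    obtain ⟨r, rfl⟩ := grMk_surjective _ r
    refine gr_sigma_ext (by simp)
      ⟨_, SetLike.GradedMul.mul_mem (c • (⟨1, SetLike.GradedOne.one_mem⟩ : F 0)).2 r.2⟩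
      ⟨_, SetLike.GradedMul.mul_mem r.2 (c • (⟨1, SetLike.GradedOne.one_mem⟩ : F 0)).2⟩ ?_
    simp
  smul_def := by
    rintro c ⟨i, r⟩
    obtain ⟨r, rfl⟩ := grMk_surjective _ r
    refine gr_sigma_ext (by simp) (c • r)
      ⟨_, SetLike.GradedMul.mul_mem (c • (⟨1, SetLike.GradedOne.one_mem⟩ : F 0)).2 r.2⟩ ?_
    simp

variable (F) in
/-- The associated graded algebra `gr R = ⨁ F_i / F_{<i}` of a filtered algebra. -/
abbrev AssocGraded : Type v := ⨁ i, grPiece F i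

variable (F) in
/-- The ideal `⨁_{i > 0} F_i / F_{<i}` of `gr R`, generated as a left ideal by the homogeneous
elements of positive degree. -/
def grIrrelevant : Ideal (AssocGraded F) :=
  Ideal.span {r | ∃ i > 0, ∃ s : grPiece F i, r = DirectSum.of (grPiece F) i s}

/-- The map `F_i / F_{<i} → F_i / F_{<i}` induced by a filtered endomorphism. -/
def grMapPiece (f : R →ₐ[k] R) (hf : ∀ (i : ℕ) (r : R), r ∈ F i → f r ∈ F i) (i : ℕ) :
    grPiece F i →ₗ[k] grPiece F i :=
  Submodule.mapQ _ _ (f.toLinearMap.restrict (hf i))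
    (fun _ hr => filtLT_map (f := f.toLinearMap) hf hr)

/-- The endomorphism of `gr R` induced by a filtered endomorphism of `R`. -/
def grMap (f : R →ₐ[k] R) (hf : ∀ (i : ℕ) (r : R), r ∈ F i → f r ∈ F i) :
    AssocGraded F →ₐ[k] AssocGraded F :=
  DirectSum.toAlgebra k _ (fun i => (DirectSum.lof k ℕ (grPiece F) i).comp (grMapPiece f hf i))
    (by
      change DirectSum.of (grPiece F) 0 (grMk F 0 ⟨f 1, _⟩) = DirectSum.of (grPiece F) 0 _
      congr 2
      exact Subtype.ext (map_one f))
    (fun {i j} r s => by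
      obtain ⟨r, rfl⟩ := grMk_surjective _ r
      obtain ⟨s, rfl⟩ := grMk_surjective _ s
      refine Eq.trans ?_ (DirectSum.of_mul_of _ _).symm
      change DirectSum.of (grPiece F) (i + j) (grMk F (i + j) ⟨f (r * s), _⟩) =
        DirectSum.of (grPiece F) (i + j) (grMk F (i + j) ⟨f r * f s, _⟩)
      congr 2
      exact Subtype.ext (map_mul f _ _))

theorem grMap_of (f : R →ₐ[k] R) (hf : ∀ (i : ℕ) (r : R), r ∈ F i → f r ∈ F i) (i : ℕ)
    (r : F i) : grMap f hf (DirectSum.of (grPiece F) i (grMk F i r)) =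
      DirectSum.of (grPiece F) i (grMk F i ⟨f r, hf i r r.2⟩) := by
  refine (DirectSum.toAddMonoid_of _ i _).trans rfl

theorem grMap_comp (f g : R →ₐ[k] R) (hf : ∀ (i : ℕ) (r : R), r ∈ F i → f r ∈ F i)
    (hg : ∀ (i : ℕ) (r : R), r ∈ F i → g r ∈ F i) (h : ∀ r, f (g r) = r) :
    (grMap f hf).comp (grMap g hg) = AlgHom.id k _ := by
  refine DirectSum.algHom_ext' _ _ (fun i => LinearMap.ext fun r => ?_)
  obtain ⟨r, rfl⟩ := grMk_surjective _ r
  change grMap f hf (grMap g hg (DirectSum.of (grPiece F) i (grMk F i r))) =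
    DirectSum.of (grPiece F) i (grMk F i r)
  rw [grMap_of, grMap_of]
  congr 2
  exact Subtype.ext (h r)

/-- The automorphism `gr g` of `gr R` induced by a filtered automorphism `g` of `R`. -/
def grAut (g : filteredAut F) : AssocGraded F ≃ₐ[k] AssocGraded F :=
  AlgEquiv.ofAlgHom (grMap (g : R ≃ₐ[k] R) (fun i r => (g.2 i r).2))
    (grMap ((g⁻¹ : filteredAut F) : R ≃ₐ[k] R) (fun i r => ((g⁻¹ : filteredAut F).2 i r).2))
    (grMap_comp _ _ _ _ (g : R ≃ₐ[k] R).apply_symm_apply)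
    (grMap_comp _ _ _ _ (g : R ≃ₐ[k] R).symm_apply_apply)

theorem grAut_of (g : filteredAut F) (i : ℕ) (r : F i) :
    grAut g (DirectSum.of (grPiece F) i (grMk F i r)) =
      DirectSum.of (grPiece F) i (grMk F i ⟨(g : R ≃ₐ[k] R) r, (g.2 i r).2 r.2⟩) :=
  grMap_of _ _ i r

theorem grAut_irrelevant (g : filteredAut F) :
    ∀ r ∈ grIrrelevant F, grAut g r ∈ grIrrelevant F := by
  suffices grIrrelevant F ≤ (grIrrelevant F).comap (grAut g).toRingEquiv.toRingHom from
    fun r hr => this hr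
  refine Ideal.span_le.2 ?_
  rintro _ ⟨i, hi, r, rfl⟩
  obtain ⟨r, rfl⟩ := grMk_surjective _ r
  exact Ideal.subset_span ⟨i, hi, _, grAut_of g i r⟩

end Filtered

/-! ### The homological determinant -/

section Hdet

universe u v

variable {k : Type u} [Field k] {A : Type v} [Ring A] [Algebra k A]

/-- The restriction of scalars along the automorphism `g` of `A`: it sends a left module `M` to
the module `ᵍM` with the same elements, on which `b` acts as `g b` does on `M`. It is an
equivalence of categories, in particular exact. -/
noncomputable abbrev twistFunctor (g : A ≃ₐ[k] A) : ModuleCat.{v} A ⥤ ModuleCat.{v} A :=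
  (ModuleCat.restrictScalarsEquivalenceOfRingEquiv g.toRingEquiv).functor

/-- A map `f : M → N` with `f (b m) = g(b) f(m)`, seen as an `A`-linear map `M → ᵍN`. -/
noncomputable def toTwist (g : A ≃ₐ[k] A) {M N : ModuleCat.{v} A}
    (f : M →ₛₗ[g.toRingEquiv.toRingHom] N) : M ⟶ (twistFunctor g).obj N :=
  ModuleCat.semilinearMapAddEquiv g.toRingEquiv.toRingHom M N f

/-- An automorphism `g` of `A`, seen as a `g`-semilinear map. -/
def selfSemilinear (g : A ≃ₐ[k] A) : A →ₛₗ[g.toRingEquiv.toRingHom] A where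
  toFun := g
  map_add' := map_add g
  map_smul' := map_mul g

/-- The `A`-linear map `A → ᵍA`, `b ↦ g b` (an isomorphism). -/
noncomputable def twistSelf (g : A ≃ₐ[k] A) :
    ModuleCat.of A A ⟶ (twistFunctor g).obj (ModuleCat.of A A) :=
  toTwist g (M := ModuleCat.of A A) (N := ModuleCat.of A A) (selfSemilinear g)

/-- The `A`-linear map `A / I → ᵍ(A / I)`, `b + I ↦ g b + I`, for a left ideal `I` which is
stable under `g`. -/
noncomputable def twistQuot (I : Ideal A) (g : A ≃ₐ[k] A) (hg : ∀ b ∈ I, g b ∈ I) :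
    ModuleCat.of A (A ⧸ I) ⟶ (twistFunctor g).obj (ModuleCat.of A (A ⧸ I)) :=
  toTwist g (M := ModuleCat.of A (A ⧸ I)) (N := ModuleCat.of A (A ⧸ I))
    (Submodule.mapQ I I (selfSemilinear g) hg)

/-- `c` is the homological determinant of the graded automorphism `g` of a connected graded
algebra `A` with irrelevant ideal `I` (so that `A / I` is the trivial module):
for some `d`, the spaces `Ext_A^i(A / I, A)` vanish for `i ≠ d` and `Ext_A^d(A / I, A)` is
one-dimensional (this is so for an Artin-Schelter Gorenstein algebra `A` of injective dimension
`d`), and `g` acts on `Ext_A^d(A / I, A)` by `c⁻¹`.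

Here `g` acts by transport of structure, as `φ ↦ g ∘ φ ∘ g⁻¹` for `d = 0`. So `g⁻¹` acts by `c`,
which is to say `φ ∘ g = g ∘ (c φ)` for `d = 0`, and in general that for each `e` the image of `e`
in `Ext_A^d(ᵍ(A / I), ᵍA)` and the class `c e` in `Ext_A^d(A / I, A)` become equal in
`Ext_A^d(A / I, ᵍA)`, by composition with `g : A / I → ᵍ(A / I)` and `g : A → ᵍA`. -/
def IsHdet (I : Ideal A) (g : A ≃ₐ[k] A) (hg : ∀ b ∈ I, g b ∈ I) (c : k) : Prop :=
  ∃ d : ℕ,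
    (∀ i, i ≠ d → Subsingleton (Abelian.Ext (ModuleCat.of A (A ⧸ I)) (ModuleCat.of A A) i)) ∧
    Module.finrank k (Abelian.Ext (ModuleCat.of A (A ⧸ I)) (ModuleCat.of A A) d) = 1 ∧
    ∀ e : Abelian.Ext (ModuleCat.of A (A ⧸ I)) (ModuleCat.of A A) d,
      (Abelian.Ext.mk₀ (twistQuot I g hg)).comp (e.mapExactFunctor (twistFunctor g))
        (zero_add d) = (c • e).comp (Abelian.Ext.mk₀ (twistSelf g)) (add_zero d)

instance (g : A ≃ₐ[k] A) : IsIso (twistSelf g) := by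
  rw [ConcreteCategory.isIso_iff_bijective]
  exact g.bijective

/-- The homological determinant is unique. -/
theorem IsHdet.unique {I : Ideal A} {g : A ≃ₐ[k] A} {hg : ∀ b ∈ I, g b ∈ I} {c c' : k}
    (h : IsHdet I g hg c) (h' : IsHdet I g hg c') : c = c' := by
  obtain ⟨d, -, h1, h2⟩ := h
  obtain ⟨d', h0, -, h2'⟩ := h'
  have : Nontrivial (Abelian.Ext (ModuleCat.of A (A ⧸ I)) (ModuleCat.of A A) d) :=
    Module.nontrivial_of_finrank_pos (R := k) (by omega)
  obtain rfl : d = d' := by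
    by_contra hd
    exact not_subsingleton _ (h0 d hd)
  obtain ⟨e, he⟩ := exists_ne (0 : Abelian.Ext (ModuleCat.of A (A ⧸ I)) (ModuleCat.of A A) d)
  refine smul_left_injective k he ?_
  have := congrArg (fun t => t.comp (Abelian.Ext.mk₀ (inv (twistSelf g))) (add_zero d))
    ((h2 e).symm.trans (h2' e))
  simpa [Abelian.Ext.comp_assoc_of_third_deg_zero] using this

/-- `c` is the homological determinant of the filtered automorphism `g` of `R`, that is, of the
automorphism `gr g` of the associated graded algebra `gr R`. -/
def IsFilteredHdet {R : Type v} [Ring R] [Algebra k R] (F : ℕ → Submodule k R)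
    [IsRingFiltration F (filtLT F)] (g : filteredAut F) (c : k) : Prop :=
  IsHdet (grIrrelevant F) (grAut g) (grAut_irrelevant g) c

end Hdet

/-! ### Classical generalized Weyl algebras -/

section Classical

universe u

variable {k : Type u} [Field k]

/-- The automorphism of `k[z]` with `z ↦ z - α`. -/
noncomputable abbrev shiftAut (α : k) : k[X] ≃ₐ[k] k[X] := algEquivAevalXAddC (-α)

/-- The classical generalized Weyl algebra `k[z][x, y; σ, a]` with `σ(z) = z - α`
(where `α ≠ 0`). -/
abbrev ClassicalGWA (α : k) (a : k[X]) : Type u := GWA k (shiftAut α) a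

namespace ClassicalGWA

variable (α : k) (a : k[X])

/-- The generators `x`, `y`, `z` of a classical generalized Weyl algebra, indexed by `0, 1, 2`. -/
noncomputable def gen : Fin 3 → ClassicalGWA α a :=
  ![GWA.x (shiftAut α) a, GWA.y (shiftAut α) a, GWA.coeff (shiftAut α) a X]

/-- The degrees `deg x = deg y = deg_z(a)` and `deg z = 2` of the generators. -/
noncomputable def genDeg : Fin 3 → ℕ := ![a.natDegree, a.natDegree, 2]

/-- The standard filtration: `F_i` is spanned by the words in `x`, `y`, `z` of total degree at
most `i`. -/
noncomputable def stdFiltration (i : ℕ) : Submodule k (ClassicalGWA α a) :=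
  Submodule.span k {r | ∃ w : List (Fin 3), (w.map (genDeg a)).sum ≤ i ∧ (w.map (gen α a)).prod = r}

instance : IsRingFiltration (stdFiltration α a) (filtLT (stdFiltration α a)) where
  mono _ _ hij := Submodule.span_mono fun _ ⟨w, hw, hr⟩ => ⟨w, hw.trans hij, hr⟩
  is_le {i _} hij := le_iSup₂_of_le (f := fun i _ => stdFiltration α a i) i hij le_rfl
  is_sup _ _ h := iSup₂_le h
  one_mem := Submodule.subset_span ⟨[], by simp, by simp⟩
  mul_mem {i j r s} hr hs := by
    have := Submodule.mul_mem_mul hr hs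
    rw [stdFiltration, stdFiltration, Submodule.span_mul_span] at this
    refine Submodule.span_mono ?_ this
    rintro _ ⟨_, ⟨w, hw, rfl⟩, _, ⟨w', hw', rfl⟩, rfl⟩
    exact ⟨w ++ w', by simp; omega, by simp⟩

/-- `ρ` witnesses that `a` is reflective: `a(ρ - z) = (-1)^n a(z)` with `n = deg_z(a)`. -/
def IsReflection (a : k[X]) (ρ : k) : Prop := a.comp (C ρ - X) = (-1) ^ a.natDegree * a

/-- `a` is reflective if `a(ρ - z) = (-1)^n a(z)` for some `ρ`, where `n = deg_z(a)`. -/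
def IsReflective (a : k[X]) : Prop := ∃ ρ : k, IsReflection a ρ

/-- The endomorphism of `k[z]` with `z ↦ α + ρ - z`. -/
noncomputable def flipHom (ρ : k) : k[X] →ₐ[k] k[X] := aeval (C (α + ρ) - X)

theorem shiftAut_flipHom_shiftAut (ρ : k) (d : k[X]) :
    shiftAut α (flipHom α ρ (shiftAut α d)) = flipHom α ρ d := by
  have : ((shiftAut α : k[X] →ₐ[k] k[X]).comp (flipHom α ρ)).comp
      (shiftAut α : k[X] →ₐ[k] k[X]) = flipHom α ρ := by
    refine Polynomial.algHom_ext ?_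
    simp [flipHom]
    ring
  exact DFunLike.congr_fun this d

theorem flipHom_flipHom (ρ : k) (d : k[X]) : flipHom α ρ (flipHom α ρ d) = d := by
  have : (flipHom α ρ).comp (flipHom α ρ) = AlgHom.id k _ := by
    ext
    simp [flipHom]
  exact DFunLike.congr_fun this d

variable {a}

theorem flipHom_shiftAut {ρ : k} (hρ : IsReflection a ρ) :
    flipHom α ρ (shiftAut α a) = (-1 : k) ^ a.natDegree • a := by
  have : (flipHom α ρ).comp (shiftAut α : k[X] →ₐ[k] k[X]) = aeval (C ρ - X) := by
    refine Polynomial.algHom_ext ?_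
    simp [flipHom]
    ring
  refine (DFunLike.congr_fun this a).trans ?_
  rw [← Polynomial.comp_eq_aeval, hρ, smul_eq_C_mul]
  simp

theorem shiftAut_smul {ρ : k} (hρ : IsReflection a ρ) :
    (-1 : k) ^ a.natDegree • shiftAut α a = flipHom α ρ a := by
  rw [← shiftAut_flipHom_shiftAut, flipHom_shiftAut α hρ, map_smul]

/-- The endomorphism `x ↦ c y`, `y ↦ e x`, `z ↦ α + ρ - z`, where `c e = (-1)^n`. -/
noncomputable def OmegaHom {ρ : k} (hρ : IsReflection a ρ) (c e : k)
    (h : c * e = (-1) ^ a.natDegree) : ClassicalGWA α a →ₐ[k] ClassicalGWA α a :=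
  GWA.lift ((GWA.coeff (shiftAut α) a).comp (flipHom α ρ))
    (c • GWA.y (shiftAut α) a) (e • GWA.x (shiftAut α) a)
    (by rw [smul_mul_smul_comm, GWA.y_mul_x, h, AlgHom.comp_apply, flipHom_shiftAut α hρ, map_smul])
    (by rw [smul_mul_smul_comm, GWA.x_mul_y, mul_comm, h, AlgHom.comp_apply, ← shiftAut_smul α hρ,
      map_smul])
    (fun d => by
      rw [smul_mul_assoc, mul_smul_comm, AlgHom.comp_apply, GWA.y_mul_coeff, AlgHom.comp_apply,
        ← shiftAut_flipHom_shiftAut α ρ d, AlgEquiv.symm_apply_apply])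
    (fun d => by
      rw [smul_mul_assoc, mul_smul_comm, AlgHom.comp_apply, GWA.x_mul_coeff, AlgHom.comp_apply,
        ← shiftAut_flipHom_shiftAut α ρ ((shiftAut α).symm d), AlgEquiv.apply_symm_apply])

theorem OmegaHom_comp {ρ : k} (hρ : IsReflection a ρ) (c e c' e' : k)
    (h : c * e = (-1) ^ a.natDegree) (h' : c' * e' = (-1) ^ a.natDegree)
    (h1 : c' * e = 1) (h2 : e' * c = 1) :
    (OmegaHom α hρ c e h).comp (OmegaHom α hρ c' e' h') = AlgHom.id k _ := by
  apply GWA.algHom_ext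
  · intro d
    simp [OmegaHom, flipHom_flipHom]
  · simp [OmegaHom, smul_smul, h1]
  · simp [OmegaHom, smul_smul, h2]

/-- The automorphism `Ω : x ↦ y, y ↦ (-1)^n x, z ↦ α + ρ - z` of the classical generalized Weyl
algebra of a polynomial `a` of degree `n` with `a(ρ - z) = (-1)^n a(z)`. -/
noncomputable def Omega {ρ : k} (hρ : IsReflection a ρ) :
    ClassicalGWA α a ≃ₐ[k] ClassicalGWA α a :=
  AlgEquiv.ofAlgHom
    (OmegaHom α hρ 1 ((-1) ^ a.natDegree) (one_mul _))
    (OmegaHom α hρ ((-1) ^ a.natDegree) 1 (mul_one _))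
    (OmegaHom_comp α hρ _ _ _ _ _ _ (by rw [← mul_pow]; simp) (by simp))
    (OmegaHom_comp α hρ _ _ _ _ _ _ (by simp) (by rw [← mul_pow]; simp))

theorem Omega_x {ρ : k} (hρ : IsReflection a ρ) :
    Omega α hρ (GWA.x (shiftAut α) a) = GWA.y (shiftAut α) a := by
  simp [Omega, OmegaHom]

theorem Omega_y {ρ : k} (hρ : IsReflection a ρ) :
    Omega α hρ (GWA.y (shiftAut α) a) = (-1 : k) ^ a.natDegree • GWA.x (shiftAut α) a := by
  simp [Omega, OmegaHom]

theorem Omega_z {ρ : k} (hρ : IsReflection a ρ) :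
    Omega α hρ (GWA.coeff (shiftAut α) a X) = GWA.coeff (shiftAut α) a (C (α + ρ) - X) := by
  simp [Omega, OmegaHom, flipHom]

end ClassicalGWA

end Classical

/-! ### Cyclic modules and multiplication maps -/

section CyclicModules

universe v

variable {A : Type v} [CommRing A]

/-- The map `A / I → A / L` induced by multiplication by `r`. -/
def quotMul (I L : Ideal A) (r : A) (h : ∀ b ∈ I, r * b ∈ L) :
    ModuleCat.of A (A ⧸ I) ⟶ ModuleCat.of A (A ⧸ L) :=
  ModuleCat.ofHom (Submodule.mapQ I L (LinearMap.mulLeft A r) h)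

theorem quotMul_mk {I L : Ideal A} {r : A} (h : ∀ b ∈ I, r * b ∈ L) (b : A) :
    (quotMul I L r h).hom (Submodule.Quotient.mk b) = Submodule.Quotient.mk (r * b) := rfl

theorem cyclic_hom_ext {I : Ideal A} {M : ModuleCat.{v} A} {f g : ModuleCat.of A (A ⧸ I) ⟶ M}
    (h : f.hom (Submodule.Quotient.mk 1) = g.hom (Submodule.Quotient.mk 1)) : f = g := by
  refine ModuleCat.hom_ext (Submodule.linearMap_qext _ (LinearMap.ext_ring h))

theorem quotMul_comp {I L M : Ideal A} {r s t : A} (h : ∀ b ∈ I, r * b ∈ L)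
    (h' : ∀ b ∈ L, s * b ∈ M) (h'' : ∀ b ∈ I, t * b ∈ M) (ht : s * r - t ∈ M) :
    quotMul I L r h ≫ quotMul L M s h' = quotMul I M t h'' := by
  refine cyclic_hom_ext ?_
  rw [ModuleCat.hom_comp, LinearMap.comp_apply, quotMul_mk, quotMul_mk, quotMul_mk,
    Submodule.Quotient.eq]
  simpa using ht

theorem quotMul_eq_smul_id {I : Ideal A} (r : A) (h : ∀ b ∈ I, r * b ∈ I) :
    quotMul I I r h = r • 𝟙 _ :=
  cyclic_hom_ext rfl

theorem quotMul_eq_zero {I L : Ideal A} {r : A} (h : ∀ b ∈ I, r * b ∈ L) (hr : r ∈ L) :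
    quotMul I L r h = 0 := by
  refine cyclic_hom_ext ?_
  rw [quotMul_mk, mul_one]
  exact (Submodule.Quotient.mk_eq_zero _).2 hr

/-- The sequence `A / I' → A / I → A / L`, where the first map is the multiplication by `r` and
the second one is the projection. -/
abbrev quotSeq (I' I L : Ideal A) (r : A) (h : ∀ b, r * b ∈ I ↔ b ∈ I')
    (h' : ∀ b, b ∈ L ↔ ∃ c, b - r * c ∈ I) : ShortComplex (ModuleCat.{v} A) where
  f := quotMul I' I r (fun b hb => (h b).2 hb)
  g := quotMul I L 1 (fun b hb => (h' _).2 ⟨0, by simpa using hb⟩)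
  zero := by
    rw [quotMul_comp (t := 1 * r) _ _
      (fun b _ => (h' _).2 ⟨b, by simp⟩) (by simp)]
    exact quotMul_eq_zero _ ((h' _).2 ⟨1, by simp⟩)

theorem quotSeq_shortExact (I' I L : Ideal A) (r : A) (h : ∀ b, r * b ∈ I ↔ b ∈ I')
    (h' : ∀ b, b ∈ L ↔ ∃ c, b - r * c ∈ I) : (quotSeq I' I L r h h').ShortExact where
  exact := by
    rw [ShortComplex.moduleCat_exact_iff]
    intro b hb
    obtain ⟨b, rfl⟩ := Submodule.Quotient.mk_surjective _ b
    have hb' : (Submodule.Quotient.mk (1 * b) : A ⧸ L) = 0 := hb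
    rw [Submodule.Quotient.mk_eq_zero, one_mul, h'] at hb'
    obtain ⟨c, hc⟩ := hb'
    refine ⟨Submodule.Quotient.mk c, ?_⟩
    refine ((Submodule.Quotient.eq I).2 ?_ : (Submodule.Quotient.mk (r * c) : A ⧸ I) = _)
    rw [← neg_sub]
    exact I.neg_mem hc
  mono_f := by
    rw [ModuleCat.mono_iff_injective]
    refine (injective_iff_map_eq_zero (quotMul I' I r _).hom).2 fun b hb => ?_
    obtain ⟨b, rfl⟩ := Submodule.Quotient.mk_surjective _ b
    rw [quotMul_mk, Submodule.Quotient.mk_eq_zero, h] at hb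
    exact (Submodule.Quotient.mk_eq_zero _).2 hb
  epi_g := by
    rw [ModuleCat.epi_iff_surjective]
    intro b
    obtain ⟨b, rfl⟩ := Submodule.Quotient.mk_surjective _ b
    exact ⟨Submodule.Quotient.mk b, congrArg Submodule.Quotient.mk (one_mul b)⟩

/-- The isomorphism `A / 0 → A`. -/
noncomputable def quotBotIso : ModuleCat.of A (A ⧸ (⊥ : Ideal A)) ≅ ModuleCat.of A A :=
  (Submodule.quotEquivOfEqBot (⊥ : Ideal A) rfl).toModuleIso

end CyclicModules

/-! ### Extensions of cyclic modules by the ring -/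

section ExtCyclic

universe v

open Abelian

variable {A : Type v} [CommRing A]

theorem mk₀_quotMul_comp {I : Ideal A} (r : A) (h : ∀ b ∈ I, r * b ∈ I) {N : ModuleCat.{v} A}
    {n : ℕ} (e : Ext (ModuleCat.of A (A ⧸ I)) N n) :
    (Ext.mk₀ (quotMul I I r h)).comp e (zero_add n) = r • e := by
  rw [quotMul_eq_smul_id, Ext.mk₀_smul, Ext.smul_comp, Ext.mk₀_id_comp]

theorem ext_cyclic_zero_subsingleton {I : Ideal A} {u : A} (hu : ∀ b, u * b = 0 → b = 0)
    (h : u ∈ I) : Subsingleton (Ext (ModuleCat.of A (A ⧸ I)) (ModuleCat.of A A) 0) := by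
  refine subsingleton_of_forall_eq 0 fun e => ?_
  obtain ⟨f, rfl⟩ := (Ext.mk₀_bijective _ _).2 e
  rw [Ext.mk₀_eq_zero_iff]
  refine cyclic_hom_ext (hu _ ?_)
  rw [← smul_eq_mul]
  refine (map_smul f.hom u (Submodule.Quotient.mk 1)).symm.trans ?_
  rw [← Submodule.Quotient.mk_smul, (Submodule.Quotient.mk_eq_zero _).2, map_zero]
  simpa using h

theorem hom_eq_smul_quotBotIso (f : ModuleCat.of A (A ⧸ (⊥ : Ideal A)) ⟶ ModuleCat.of A A) :
    ∃ a : A, f = a • quotBotIso.hom :=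
  ⟨f.hom (Submodule.Quotient.mk 1), cyclic_hom_ext (mul_one (f.hom _)).symm⟩

theorem ext_bot_succ_eq_zero {N : ModuleCat.{v} A} {n : ℕ}
    (e : Ext (ModuleCat.of A (A ⧸ (⊥ : Ideal A))) N (n + 1)) : e = 0 := by
  have : Projective (ModuleCat.of A (A ⧸ (⊥ : Ideal A))) :=
    Projective.of_iso quotBotIso.symm inferInstance
  exact Ext.eq_zero_of_projective e

section OneRelation

variable {U : Ideal A} {u : A} (h : ∀ b, u * b ∈ (⊥ : Ideal A) ↔ b ∈ (⊥ : Ideal A))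
  (h' : ∀ b, b ∈ U ↔ ∃ c, b - u * c ∈ (⊥ : Ideal A))

/-- The class in `Ext¹(A / u, A)` of the extension `0 → A → A → A / u → 0`. -/
noncomputable def koszulOne : Ext (ModuleCat.of A (A ⧸ U)) (ModuleCat.of A A) 1 :=
  (quotSeq_shortExact ⊥ ⊥ U u h h').extClass.comp (Ext.mk₀ quotBotIso.hom) (add_zero 1)

include h h' in
theorem ext_quot_one_relation_eq_zero {n : ℕ}
    (e : Ext (ModuleCat.of A (A ⧸ U)) (ModuleCat.of A A) (n + 2)) : e = 0 := by
  obtain ⟨e', rfl⟩ := Ext.contravariant_sequence_exact₃ (quotSeq_shortExact ⊥ ⊥ U u h h') _ e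
    (ext_bot_succ_eq_zero _) (n₀ := n + 1) (by omega)
  rw [ext_bot_succ_eq_zero e', Ext.comp_zero]

theorem exists_smul_koszulOne (e : Ext (ModuleCat.of A (A ⧸ U)) (ModuleCat.of A A) 1) :
    ∃ a : A, e = a • koszulOne h h' := by
  obtain ⟨e', rfl⟩ := Ext.contravariant_sequence_exact₃ (quotSeq_shortExact ⊥ ⊥ U u h h') _ e
    (ext_bot_succ_eq_zero _) (n₀ := 0) (by omega)
  obtain ⟨f, rfl⟩ := (Ext.mk₀_bijective _ _).2 e'
  obtain ⟨a, rfl⟩ := hom_eq_smul_quotBotIso f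
  refine ⟨a, ?_⟩
  rw [koszulOne, Ext.mk₀_smul, Ext.comp_smul]

theorem smul_koszulOne_eq_zero {a : A} (ha : a • koszulOne h h' = 0) : a ∈ U := by
  rw [koszulOne, ← Ext.comp_smul, ← Ext.mk₀_smul] at ha
  obtain ⟨e', he⟩ := Ext.contravariant_sequence_exact₁ (quotSeq_shortExact ⊥ ⊥ U u h h') _ _ _ ha
  obtain ⟨f, rfl⟩ := (Ext.mk₀_bijective _ _).2 e'
  obtain ⟨c, rfl⟩ := hom_eq_smul_quotBotIso f
  rw [Ext.mk₀_comp_mk₀] at he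
  have := congrArg (fun f => f.hom (Submodule.Quotient.mk 1)) ((Ext.mk₀_bijective _ _).1 he)
  have h1 : c * (u * 1) = a * 1 := this
  exact (h' a).2 ⟨c, by rw [Submodule.mem_bot]; linear_combination -h1⟩

end OneRelation

section TwoRelations

variable {U J : Ideal A} {u v : A} (h : ∀ b, u * b ∈ (⊥ : Ideal A) ↔ b ∈ (⊥ : Ideal A))
  (h' : ∀ b, b ∈ U ↔ ∃ c, b - u * c ∈ (⊥ : Ideal A))
  (hv : ∀ b, v * b ∈ U ↔ b ∈ U) (hv' : ∀ b, b ∈ J ↔ ∃ c, b - v * c ∈ U)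

/-- The class in `Ext²(A / (u, v), A)` of the Koszul complex of a regular sequence `u, v`. -/
noncomputable def koszulTwo : Ext (ModuleCat.of A (A ⧸ J)) (ModuleCat.of A A) 2 :=
  (quotSeq_shortExact U U J v hv hv').extClass.comp (koszulOne h h') (by rfl : 1 + 1 = 2)

include h h' in
theorem ext_quot_two_relations_zero :
    Subsingleton (Ext (ModuleCat.of A (A ⧸ U)) (ModuleCat.of A A) 0) :=
  ext_cyclic_zero_subsingleton (u := u) (fun b hb => by simpa using (h b).1 (by simpa using hb))
    ((h' u).2 ⟨1, by simp⟩)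

include h h' hv hv' in
theorem ext_quot_two_relations_subsingleton (i : ℕ) (hi : i ≠ 2) :
    Subsingleton (Ext (ModuleCat.of A (A ⧸ J)) (ModuleCat.of A A) i) := by
  refine subsingleton_of_forall_eq 0 fun e => ?_
  match i, hi, e with
  | 0, _, e =>
    have := ext_cyclic_zero_subsingleton (I := J) (u := u)
      (fun b hb => by simpa using (h b).1 (by simpa using hb))
      ((hv' u).2 ⟨0, by simpa using (h' u).2 ⟨1, by simp⟩⟩)
    exact Subsingleton.elim _ _
  | 1, _, e =>
    have := ext_quot_two_relations_zero h h'
    obtain ⟨e', rfl⟩ := Ext.contravariant_sequence_exact₃ (quotSeq_shortExact U U J v hv hv') _ e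
      (by
        obtain ⟨a, ha⟩ := exists_smul_koszulOne h h'
          ((Ext.mk₀ (quotSeq U U J v hv hv').g).comp e (zero_add 1))
        refine ha.trans ?_
        have h0 := congrArg (fun t => (Ext.mk₀ (quotSeq U U J v hv hv').f).comp t (zero_add 1)) ha
        beta_reduce at h0
        rw [Ext.mk₀_comp_mk₀_assoc, ShortComplex.zero, Ext.mk₀_zero, Ext.zero_comp] at h0
        have h1 := h0.trans (mk₀_quotMul_comp v _ _)
        rw [smul_smul] at h1
        have := (h' a).1 ((hv a).1 (smul_koszulOne_eq_zero h h' h1.symm))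
        obtain ⟨c, hc⟩ := this
        have hu : u • koszulOne h h' = 0 := by
          rw [← mk₀_quotMul_comp u (fun b hb => U.mul_mem_left _ hb), quotMul_eq_zero _
            ((h' u).2 ⟨1, by simp⟩), Ext.mk₀_zero, Ext.zero_comp]
        rw [show a = c * u by linear_combination (Submodule.mem_bot A).1 hc, ← smul_smul, hu,
          smul_zero]) (n₀ := 0) (by omega)
    rw [Subsingleton.elim e' 0, Ext.comp_zero]
  | n + 3, _, e =>
    obtain ⟨e', rfl⟩ := Ext.contravariant_sequence_exact₃ (quotSeq_shortExact U U J v hv hv') _ e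
      (ext_quot_one_relation_eq_zero h h' (n := n + 1) _) (n₀ := n + 2) (by omega)
    rw [ext_quot_one_relation_eq_zero h h' e', Ext.comp_zero]

theorem exists_smul_koszulTwo (e : Ext (ModuleCat.of A (A ⧸ J)) (ModuleCat.of A A) 2) :
    ∃ a : A, e = a • koszulTwo h h' hv hv' := by
  obtain ⟨e', rfl⟩ := Ext.contravariant_sequence_exact₃ (quotSeq_shortExact U U J v hv hv') _ e
    (ext_quot_one_relation_eq_zero h h' (n := 0) _) (n₀ := 1) (by omega)
  obtain ⟨a, rfl⟩ := exists_smul_koszulOne h h' e'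
  exact ⟨a, Ext.comp_smul _ _ _ _⟩

theorem smul_koszulTwo_eq_zero_iff {a : A} : a • koszulTwo h h' hv hv' = 0 ↔ a ∈ J := by
  constructor
  · intro ha
    rw [koszulTwo, ← Ext.comp_smul] at ha
    obtain ⟨e', he⟩ := Ext.contravariant_sequence_exact₁ (quotSeq_shortExact U U J v hv hv')
      _ _ _ ha
    obtain ⟨c, rfl⟩ := exists_smul_koszulOne h h' e'
    have h1 := he.symm.trans (mk₀_quotMul_comp v _ _)
    rw [smul_smul, ← sub_eq_zero, ← sub_smul] at h1
    exact (hv' a).2 ⟨c, smul_koszulOne_eq_zero h h' h1⟩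
  · intro ha
    rw [← mk₀_quotMul_comp a (fun b hb => J.mul_mem_left _ hb), quotMul_eq_zero _ ha,
      Ext.mk₀_zero, Ext.zero_comp]

end TwoRelations

section ExactPair

variable {J Z W : Ideal A} {z w : A}
  (hzW : ∀ b, z * b ∈ J ↔ b ∈ W) (hzZ : ∀ b, b ∈ Z ↔ ∃ c, b - z * c ∈ J)
  (hwZ : ∀ b, w * b ∈ J ↔ b ∈ Z) (hwW : ∀ b, b ∈ W ↔ ∃ c, b - w * c ∈ J)
  {N : ModuleCat.{v} A} (hJ : ∀ i ≠ 2, Subsingleton (Ext (ModuleCat.of A (A ⧸ J)) N i))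
  {ε : Ext (ModuleCat.of A (A ⧸ J)) N 2} (hε : ∀ e, ∃ a : A, e = a • ε)
  (hε' : ∀ a : A, a • ε = 0 ↔ a ∈ J)

/-- The projection `A / J → A / (J + z)`. -/
def quotSpanProj (hzZ : ∀ b, b ∈ Z ↔ ∃ c, b - z * c ∈ J) :
    ModuleCat.of A (A ⧸ J) ⟶ ModuleCat.of A (A ⧸ Z) :=
  quotMul J Z 1 fun b hb => (hzZ _).2 ⟨0, by simpa using hb⟩

include hzZ in
instance quotSpanProj_epi : Epi (quotSpanProj hzZ) := by
  rw [ModuleCat.epi_iff_surjective]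
  intro b
  obtain ⟨b, rfl⟩ := Submodule.Quotient.mk_surjective _ b
  exact ⟨Submodule.Quotient.mk b, congrArg Submodule.Quotient.mk (one_mul b)⟩

include hJ hzZ in
theorem exactPair_zero : Subsingleton (Ext (ModuleCat.of A (A ⧸ Z)) N 0) := by
  have := hJ 0 (by omega)
  exact (Ext.precomp_mk₀_injective_of_epi N (quotSpanProj hzZ)).subsingleton

include hJ hzW hzZ hwW in
theorem exactPair_one : Subsingleton (Ext (ModuleCat.of A (A ⧸ Z)) N 1) := by
  refine subsingleton_of_forall_eq 0 fun e => ?_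
  have := hJ 1 (by omega)
  have := exactPair_zero hwW hJ
  obtain ⟨e', rfl⟩ := Ext.contravariant_sequence_exact₃ (quotSeq_shortExact W J Z z hzW hzZ) _ e
    (Subsingleton.elim (α := Ext (ModuleCat.of A (A ⧸ J)) N 1) _ _) (n₀ := 0) (by omega)
  rw [Subsingleton.elim (α := Ext (ModuleCat.of A (A ⧸ W)) N 0) e' 0, Ext.comp_zero]

include hzW hwZ hwW hJ in
theorem exactPair_two_injective {e : Ext (ModuleCat.of A (A ⧸ Z)) N 2}
    (he : (Ext.mk₀ (quotSpanProj hzZ)).comp e (zero_add 2) = 0) : e = 0 := by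
  have := exactPair_one hwZ hwW hzZ hJ
  obtain ⟨e', rfl⟩ := Ext.contravariant_sequence_exact₃ (quotSeq_shortExact W J Z z hzW hzZ) _ e
    he (n₀ := 1) (by omega)
  rw [Subsingleton.elim (α := Ext (ModuleCat.of A (A ⧸ W)) N 1) e' 0, Ext.comp_zero]

include hzW hwW in
theorem quotSpanProj_comp_quotMul :
    quotSpanProj hwW ≫ quotMul W J z (fun b hb => (hzW b).2 hb) =
      quotMul J J z (fun _ hb => J.mul_mem_left _ hb) :=
  quotMul_comp _ _ _ (by simp)

include hzW hzZ hwW hε hε' in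
theorem exactPair_two_exists (e : Ext (ModuleCat.of A (A ⧸ Z)) N 2) :
    ∃ a : A, (Ext.mk₀ (quotSpanProj hzZ)).comp e (zero_add 2) = (a * w) • ε := by
  obtain ⟨a, ha⟩ := hε ((Ext.mk₀ (quotSpanProj hzZ)).comp e (zero_add 2))
  have h1 : z • a • ε = 0 := by
    rw [← ha, ← mk₀_quotMul_comp z (fun b hb => J.mul_mem_left _ hb), Ext.mk₀_comp_mk₀_assoc,
      ← quotSpanProj_comp_quotMul hzW hwW, Category.assoc]
    have : quotMul W J z (fun b hb => (hzW b).2 hb) ≫ quotSpanProj hzZ = 0 :=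
      (quotSeq W J Z z hzW hzZ).zero
    rw [this, Limits.comp_zero, Ext.mk₀_zero, Ext.zero_comp]
  rw [smul_smul, hε', hzW, hwW] at h1
  obtain ⟨c, hc⟩ := h1
  refine ⟨c, ha.trans ?_⟩
  rw [← sub_eq_zero, ← sub_smul, hε', mul_comm]
  exact hc

include hzW hwZ hwW hε' hJ in
theorem exactPair_two_surjective : ∃ e : Ext (ModuleCat.of A (A ⧸ Z)) N 2,
    (Ext.mk₀ (quotSpanProj hzZ)).comp e (zero_add 2) = w • ε := by
  refine Ext.contravariant_sequence_exact₂ (quotSeq_shortExact W J Z z hzW hzZ) _ (w • ε) ?_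
  refine exactPair_two_injective hwZ hwW hzW hzZ hJ ?_
  refine (Ext.mk₀_comp_mk₀_assoc _ _ _).trans ?_
  change (Ext.mk₀ (quotSpanProj hwW ≫ quotMul W J z _)).comp _ _ = 0
  rw [quotSpanProj_comp_quotMul hzW hwW, mk₀_quotMul_comp, smul_smul, hε', hzW, hwW]
  exact ⟨1, by simp⟩

include hzW hzZ hwZ hwW hε hε' hJ in
theorem exactPair_three : Subsingleton (Ext (ModuleCat.of A (A ⧸ Z)) N 3) := by
  refine subsingleton_of_forall_eq 0 fun e => ?_
  have := hJ 3 (by omega)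
  obtain ⟨f, rfl⟩ := Ext.contravariant_sequence_exact₃ (quotSeq_shortExact W J Z z hzW hzZ) _ e
    (Subsingleton.elim (α := Ext (ModuleCat.of A (A ⧸ J)) N 3) _ _) (n₀ := 2) (by omega)
  obtain ⟨a, ha⟩ := exactPair_two_exists hwZ hwW hzZ hε hε' f
  have hf : f = (Ext.mk₀ (quotSeq W J Z z hzW hzZ).f).comp (a • ε) (zero_add 2) := by
    rw [← sub_eq_zero]
    refine exactPair_two_injective hwZ hwW hzW hzZ hJ ?_
    rw [sub_eq_add_neg, Ext.comp_add, Ext.comp_neg, ← sub_eq_add_neg, sub_eq_zero, ha]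
    refine Eq.symm ((Ext.mk₀_comp_mk₀_assoc _ _ _).trans ?_)
    change (Ext.mk₀ (quotSpanProj hwW ≫ quotMul W J z _)).comp _ _ = _
    rw [quotSpanProj_comp_quotMul hzW hwW, mk₀_quotMul_comp, smul_smul, mul_comm]
  rw [hf]
  exact ShortComplex.ShortExact.extClass_comp_assoc _ _

include hzW hzZ hwZ hwW hε hε' hJ in
theorem exactPair_add_three (i : ℕ) :
    Subsingleton (Ext (ModuleCat.of A (A ⧸ Z)) N (i + 3)) ∧
      Subsingleton (Ext (ModuleCat.of A (A ⧸ W)) N (i + 3)) := by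
  induction i with
  | zero => exact ⟨exactPair_three hzW hzZ hwZ hwW hJ hε hε',
      exactPair_three hwZ hwW hzW hzZ hJ hε hε'⟩
  | succ i ih =>
    obtain ⟨ihZ, ihW⟩ := ih
    have := hJ (i + 1 + 3) (by omega)
    constructor <;> refine subsingleton_of_forall_eq 0 fun e => ?_
    · obtain ⟨f, rfl⟩ := Ext.contravariant_sequence_exact₃ (quotSeq_shortExact W J Z z hzW hzZ) _ e
        (Subsingleton.elim (α := Ext (ModuleCat.of A (A ⧸ J)) N (i + 1 + 3)) _ _)
        (n₀ := i + 3) (by omega)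
      rw [Subsingleton.elim (α := Ext (ModuleCat.of A (A ⧸ W)) N (i + 3)) f 0, Ext.comp_zero]
    · obtain ⟨f, rfl⟩ := Ext.contravariant_sequence_exact₃ (quotSeq_shortExact Z J W w hwZ hwW) _ e
        (Subsingleton.elim (α := Ext (ModuleCat.of A (A ⧸ J)) N (i + 1 + 3)) _ _)
        (n₀ := i + 3) (by omega)
      rw [Subsingleton.elim (α := Ext (ModuleCat.of A (A ⧸ Z)) N (i + 3)) f 0, Ext.comp_zero]

include hzW hzZ hwZ hwW hε hε' hJ in
theorem exactPair_subsingleton (i : ℕ) (hi : i ≠ 2) :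
    Subsingleton (Ext (ModuleCat.of A (A ⧸ Z)) N i) := by
  match i, hi with
  | 0, _ => exact exactPair_zero hzZ hJ
  | 1, _ => exact exactPair_one hzW hzZ hwW hJ
  | i + 3, _ => exact (exactPair_add_three hzW hzZ hwZ hwW hJ hε hε' i).1

end ExactPair

end ExtCyclic

/-! ### Homological determinants and regular sequences of eigenvectors -/

section HdetEigen

universe u v

open Abelian

variable {k : Type u} [Field k] {A : Type v} [CommRing A] [Algebra k A]

theorem ext_algebraMap_smul {M N : ModuleCat.{v} A} {n : ℕ} (c : k) (e : Ext M N n) :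
    algebraMap k A c • e = c • e := by
  rw [Ext.smul_eq_comp_mk₀, Ext.smul_eq_comp_mk₀]
  rfl

variable (g : A ≃ₐ[k] A)

theorem quotMul_comp_twistQuot {I L : Ideal A} (hI : ∀ b ∈ I, g b ∈ I) (hL : ∀ b ∈ L, g b ∈ L)
    {r : A} {c : k} (hr : g r = c • r) (h : ∀ b ∈ I, r * b ∈ L) :
    quotMul I L r h ≫ twistQuot L g hL =
      (c • twistQuot I g hI) ≫ (twistFunctor g).map (quotMul I L r h) := by
  refine ModuleCat.hom_ext (Submodule.linearMap_qext _ (LinearMap.ext fun b => ?_))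
  change (Submodule.Quotient.mk (g (r * b)) : A ⧸ L) =
    (quotMul I L r h).hom (g (algebraMap k A c) • Submodule.Quotient.mk (g b))
  rw [map_smul, quotMul_mk, ← Submodule.Quotient.mk_smul, map_mul, hr, AlgEquiv.commutes,
    Algebra.smul_def, smul_eq_mul, mul_assoc]

/-- The map of short complexes induced by an automorphism `g` which maps `r` to `c r`. -/
noncomputable def quotSeqTwist (I' I L : Ideal A) {r : A} (h : ∀ b, r * b ∈ I ↔ b ∈ I')
    (h' : ∀ b, b ∈ L ↔ ∃ c, b - r * c ∈ I) (hI' : ∀ b ∈ I', g b ∈ I') (hI : ∀ b ∈ I, g b ∈ I)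
    (hL : ∀ b ∈ L, g b ∈ L) {c : k} (hr : g r = c • r) :
    quotSeq I' I L r h h' ⟶ (quotSeq I' I L r h h').map (twistFunctor g) where
  τ₁ := c • twistQuot I' g hI'
  τ₂ := twistQuot I g hI
  τ₃ := twistQuot L g hL
  comm₁₂ := (quotMul_comp_twistQuot g hI' hI hr _).symm
  comm₂₃ := by
    have := quotMul_comp_twistQuot g hI hL (r := 1) (c := (1 : k)) (by simp)
      (fun b hb => (h' _).2 ⟨0, by simpa using hb⟩)
    rw [one_smul] at this
    exact this.symm

theorem twistQuot_comp_extClass (I' I L : Ideal A) {r : A} (h : ∀ b, r * b ∈ I ↔ b ∈ I')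
    (h' : ∀ b, b ∈ L ↔ ∃ c, b - r * c ∈ I) (hI' : ∀ b ∈ I', g b ∈ I') (hI : ∀ b ∈ I, g b ∈ I)
    (hL : ∀ b ∈ L, g b ∈ L) {c : k} (hr : g r = c • r) :
    (Ext.mk₀ (twistQuot L g hL)).comp
        ((quotSeq_shortExact I' I L r h h').extClass.mapExactFunctor (twistFunctor g))
        (zero_add 1) =
      c • (quotSeq_shortExact I' I L r h h').extClass.comp (Ext.mk₀ (twistQuot I' g hI'))
        (add_zero 1) := by
  rw [Ext.mapExactFunctor_extClass, ← Ext.comp_smul, ← Ext.mk₀_smul]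
  exact (ShortComplex.ShortExact.extClass_naturality _ _
    (quotSeqTwist g I' I L h h' hI' hI hL hr)).symm

theorem twistQuot_comp_quotBotIso (h : ∀ b ∈ (⊥ : Ideal A), g b ∈ (⊥ : Ideal A)) :
    twistQuot ⊥ g h ≫ (twistFunctor g).map quotBotIso.hom = quotBotIso.hom ≫ twistSelf g :=
  ModuleCat.hom_ext (Submodule.linearMap_qext _ (LinearMap.ext fun _ => rfl))

theorem smul_id_comp_twistSelf {a : A} {c : k} (ha : g a = c • a) :
    (a • 𝟙 (ModuleCat.of A A)) ≫ twistSelf g =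
      c • (twistSelf g ≫ (twistFunctor g).map (a • 𝟙 (ModuleCat.of A A))) := by
  refine ModuleCat.hom_ext (LinearMap.ext fun b => ?_)
  change g (a * b) = g (algebraMap k A c) * (a * g b)
  rw [map_mul, ha, AlgEquiv.commutes, Algebra.smul_def, mul_assoc]

section Koszul

variable {U J : Ideal A} {u v : A} (h : ∀ b, u * b ∈ (⊥ : Ideal A) ↔ b ∈ (⊥ : Ideal A))
  (h' : ∀ b, b ∈ U ↔ ∃ c, b - u * c ∈ (⊥ : Ideal A))
  (hv : ∀ b, v * b ∈ U ↔ b ∈ U) (hv' : ∀ b, b ∈ J ↔ ∃ c, b - v * c ∈ U)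
  (hU : ∀ b ∈ U, g b ∈ U) (hJ : ∀ b ∈ J, g b ∈ J) {μ ν : k} (hgu : g u = μ • u)
  (hgv : g v = ν • v)

include hgu in
theorem twistQuot_comp_koszulOne :
    (Ext.mk₀ (twistQuot U g hU)).comp ((koszulOne h h').mapExactFunctor (twistFunctor g))
        (zero_add 1) =
      μ • (koszulOne h h').comp (Ext.mk₀ (twistSelf g)) (add_zero 1) := by
  have h0 : ∀ b ∈ (⊥ : Ideal A), g b ∈ (⊥ : Ideal A) := fun b hb => by
    rw [Submodule.mem_bot] at *; rw [hb, map_zero]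
  rw [koszulOne, Ext.mapExactFunctor_comp, Ext.mapExactFunctor_mk₀,
    ← Ext.comp_assoc_of_third_deg_zero, twistQuot_comp_extClass g ⊥ ⊥ U h h' h0 h0 hU hgu,
    Ext.smul_comp, Ext.comp_assoc_of_third_deg_zero, Ext.mk₀_comp_mk₀, twistQuot_comp_quotBotIso,
    Ext.comp_assoc_of_third_deg_zero, Ext.mk₀_comp_mk₀]

include hU hgu hgv in
theorem twistQuot_comp_koszulTwo :
    (Ext.mk₀ (twistQuot J g hJ)).comp
        ((koszulTwo h h' hv hv').mapExactFunctor (twistFunctor g)) (zero_add 2) =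
      (μ * ν) • (koszulTwo h h' hv hv').comp (Ext.mk₀ (twistSelf g)) (add_zero 2) := by
  rw [koszulTwo, Ext.mapExactFunctor_comp, ← Ext.comp_assoc (a₁₂ := 1) _ _ _ (by rfl) (by rfl)
    (by rfl), twistQuot_comp_extClass g U U J hv hv' hU hU hJ hgv, Ext.smul_comp,
    Ext.comp_assoc_of_second_deg_zero, twistQuot_comp_koszulOne g h h' hU hgu, Ext.comp_smul,
    smul_smul, mul_comm, Ext.comp_assoc_of_third_deg_zero]

include hU hgu hgv in
theorem twistQuot_comp_smul_koszulTwo {w : A} (hw : g w = (μ * ν) • w) :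
    (Ext.mk₀ (twistQuot J g hJ)).comp
        ((w • koszulTwo h h' hv hv').mapExactFunctor (twistFunctor g)) (zero_add 2) =
      (w • koszulTwo h h' hv hv').comp (Ext.mk₀ (twistSelf g)) (add_zero 2) := by
  rw [Ext.smul_eq_comp_mk₀, Ext.mapExactFunctor_comp, Ext.mapExactFunctor_mk₀,
    ← Ext.comp_assoc_of_third_deg_zero, twistQuot_comp_koszulTwo g h h' hv hv' hU hJ hgu hgv,
    Ext.smul_comp, Ext.comp_assoc_of_third_deg_zero, Ext.mk₀_comp_mk₀,
    Ext.comp_assoc_of_third_deg_zero, Ext.mk₀_comp_mk₀, smul_id_comp_twistSelf g hw,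
    Ext.mk₀_smul, Ext.comp_smul]

end Koszul

/-- If `u, v` is a regular sequence in `A`, the elements `z` and `w` are a pair of exact zero
divisors modulo `(u, v)`, and `A / (u, v, z) = k`, then an automorphism which maps `u` to `μ u`,
`v` to `ν v`, `z` to a multiple of `z`, and `w` to `μ ν w` has homological determinant `1`. -/
theorem isHdet_one_of_exactPair {U J Z W : Ideal A} {u v z w : A}
    (h : ∀ b, u * b ∈ (⊥ : Ideal A) ↔ b ∈ (⊥ : Ideal A))
    (h' : ∀ b, b ∈ U ↔ ∃ c, b - u * c ∈ (⊥ : Ideal A))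
    (hv : ∀ b, v * b ∈ U ↔ b ∈ U) (hv' : ∀ b, b ∈ J ↔ ∃ c, b - v * c ∈ U)
    (hzW : ∀ b, z * b ∈ J ↔ b ∈ W) (hzZ : ∀ b, b ∈ Z ↔ ∃ c, b - z * c ∈ J)
    (hwZ : ∀ b, w * b ∈ J ↔ b ∈ Z) (hwW : ∀ b, b ∈ W ↔ ∃ c, b - w * c ∈ J)
    (hZ : (1 : A) ∉ Z) (hk : ∀ b, ∃ c : k, b - algebraMap k A c ∈ Z)
    (hg : ∀ b ∈ Z, g b ∈ Z) {μ ν : k} (hgu : g u = μ • u) (hgv : g v = ν • v)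
    (hgw : g w = (μ * ν) • w) : IsHdet Z g hg 1 := by
  have hU : ∀ b ∈ U, g b ∈ U := fun b hb => by
    obtain ⟨c, hc⟩ := (h' b).1 hb
    rw [Submodule.mem_bot, sub_eq_zero] at hc
    refine (h' _).2 ⟨μ • g c, ?_⟩
    rw [hc, map_mul, hgu]
    simp
  have hJ : ∀ b ∈ J, g b ∈ J := fun b hb => by
    obtain ⟨c, hc⟩ := (hv' b).1 hb
    refine (hv' _).2 ⟨ν • g c, ?_⟩
    have := hU _ hc
    rw [map_sub, map_mul, hgv] at this
    simpa using this
  have hJE := ext_quot_two_relations_subsingleton h h' hv hv'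
  have hε := exists_smul_koszulTwo h h' hv hv'
  have hε' : ∀ a, a • koszulTwo h h' hv hv' = 0 ↔ a ∈ J :=
    fun a => smul_koszulTwo_eq_zero_iff h h' hv hv'
  have hinj := fun e => exactPair_two_injective hzW hzZ hwZ hwW hJE (e := e)
  have hex : ∀ e, ∃ c : k, (Ext.mk₀ (quotSpanProj hzZ)).comp e (zero_add 2) =
      c • w • koszulTwo h h' hv hv' := by
    intro e
    obtain ⟨a, ha⟩ := exactPair_two_exists hzW hzZ hwW hε hε' e
    obtain ⟨c, hc⟩ := hk a
    refine ⟨c, ha.trans ?_⟩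
    rw [← ext_algebraMap_smul, smul_smul, ← sub_eq_zero, ← sub_smul, hε', ← sub_mul, mul_comm, hwZ]
    exact hc
  refine ⟨2, fun i hi => exactPair_subsingleton hzW hzZ hwZ hwW hJE hε hε' i hi, ?_, ?_⟩
  · obtain ⟨e₀, he₀⟩ := exactPair_two_surjective hzW hzZ hwZ hwW hJE hε'
    refine finrank_eq_one e₀ ?_ fun e => ?_
    · rintro rfl
      rw [Ext.comp_zero, eq_comm, hε', ← mul_one w, hwZ] at he₀
      exact hZ he₀
    · obtain ⟨c, hc⟩ := hex e
      refine ⟨c, ?_⟩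
      rw [← sub_eq_zero]
      refine hinj _ ?_
      rw [sub_eq_add_neg, Ext.comp_add, Ext.comp_neg, Ext.comp_smul, he₀, hc, add_neg_cancel]
  · intro e
    rw [one_smul, ← sub_eq_zero]
    set x := (Ext.mk₀ (twistQuot Z g hg)).comp (e.mapExactFunctor (twistFunctor g)) (zero_add 2) -
      e.comp (Ext.mk₀ (twistSelf g)) (add_zero 2) with hx
    have hπ : (Ext.mk₀ (quotSpanProj hzZ)).comp x (zero_add 2) = 0 := by
      obtain ⟨c, hc⟩ := hex e
      have hnat : quotSpanProj hzZ ≫ twistQuot Z g hg =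
          twistQuot J g hJ ≫ (twistFunctor g).map (quotSpanProj hzZ) := by
        have := quotMul_comp_twistQuot g hJ hg (r := 1) (c := (1 : k)) (by simp)
          (fun b hb => (hzZ _).2 ⟨0, by simpa using hb⟩)
        rwa [one_smul] at this
      rw [hx, sub_eq_add_neg, Ext.comp_add, Ext.comp_neg, Ext.mk₀_comp_mk₀_assoc, hnat,
        ← Ext.mk₀_comp_mk₀_assoc, ← Ext.mapExactFunctor_mk₀, ← Ext.mapExactFunctor_comp,
        ← Ext.comp_assoc_of_third_deg_zero, hc, Functor.mapExactFunctor_smul, Ext.comp_smul,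
        twistQuot_comp_smul_koszulTwo g h h' hv hv' hU hJ hgu hgv hgw, Ext.smul_comp,
        Ext.smul_comp, Ext.smul_comp, add_neg_cancel]
    have hy : x.comp (Ext.mk₀ (inv (twistSelf g))) (add_zero 2) = 0 := by
      refine hinj _ ?_
      rw [← Ext.comp_assoc_of_third_deg_zero, hπ, Ext.zero_comp]
    have := congrArg (fun t => t.comp (Ext.mk₀ (twistSelf g)) (add_zero 2)) hy
    simpa [Ext.comp_assoc_of_third_deg_zero] using this

end HdetEigen

/-! ### Algebras which are free over a polynomial ring in two variables -/

section FreeOverPlane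

universe u v

variable {k : Type u} [Field k] {A : Type v} [CommRing A] [Algebra k A]

theorem isHdet_one_of_regular {u v z : A} {n : ℕ} (hn : 0 < n) (hu : ∀ b, u * b = 0 → b = 0)
    (huv : ∀ b c, v * b = u * c → ∃ d, b = u * d) (hz : z ^ n ∈ Ideal.span {u, v})
    (hgen : ∀ b, ∃ q : k[X], b - aeval z q ∈ Ideal.span {u, v})
    (hind : ∀ q : k[X], aeval z q ∈ Ideal.span {u, v} → X ^ n ∣ q)
    (g : A ≃ₐ[k] A) {I : Ideal A} (hI : I = Ideal.span {z, u, v}) (hg : ∀ b ∈ I, g b ∈ I)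
    {μ ν ζ : k} (hgu : g u = μ • u) (hgv : g v = ν • v) (hgz : g z = ζ • z)
    (hζ : ζ ^ (n - 1) = μ * ν) : IsHdet I g hg 1 := by
  subst hI
  have hZ : ∀ r b : A, b ∈ Ideal.span {r, u, v} ↔ ∃ c, b - r * c ∈ Ideal.span {u, v} := by
    intro r b
    rw [Ideal.mem_span_insert]
    constructor
    · rintro ⟨c, d, hd, rfl⟩
      exact ⟨c, by rwa [mul_comm, add_sub_cancel_left]⟩
    · rintro ⟨c, hc⟩
      exact ⟨c, _, hc, by ring⟩
  have hmul : ∀ (r : A) (m : ℕ), m ≤ n → r = z ^ m → ∀ b, r * b ∈ Ideal.span {u, v} ↔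
      b ∈ Ideal.span {z ^ (n - m), u, v} := by
    rintro _ m hm rfl b
    rw [hZ]
    constructor
    · intro hb
      obtain ⟨q, hq⟩ := hgen b
      have h1 : aeval z (X ^ m * q) ∈ Ideal.span {u, v} := by
        have := sub_mem hb (Ideal.mul_mem_left _ (z ^ m) hq)
        rw [map_mul, map_pow, aeval_X]
        convert this using 1
        ring
      have h2 := hind _ h1
      rw [show n = m + (n - m) by omega, pow_add] at h2
      obtain ⟨q', rfl⟩ := (mul_dvd_mul_iff_left (pow_ne_zero _ X_ne_zero)).1 h2
      exact ⟨aeval z q', by simpa using hq⟩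
    · rintro ⟨c, hc⟩
      have := add_mem (Ideal.mul_mem_left _ (z ^ m) hc) (Ideal.mul_mem_left _ c hz)
      convert this using 1
      rw [show z ^ n = z ^ m * z ^ (n - m) by rw [← pow_add]; congr 1; omega]
      ring
  refine isHdet_one_of_exactPair (U := Ideal.span {u}) (J := Ideal.span {u, v})
    (W := Ideal.span {z ^ (n - 1), u, v}) (z := z) (w := z ^ (n - 1)) g (u := u) (v := v)
    ?_ ?_ ?_ ?_ (hmul z 1 hn (pow_one z).symm) (hZ z) ?_ (hZ _) ?_ ?_ hg hgu hgv ?_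
  · intro b
    simp only [Submodule.mem_bot]
    exact ⟨hu b, fun h => by rw [h, mul_zero]⟩
  · intro b
    simp only [Submodule.mem_bot, Ideal.mem_span_singleton, sub_eq_zero]
    rfl
  · intro b
    simp only [Ideal.mem_span_singleton]
    refine ⟨fun ⟨c, hc⟩ => huv b c hc, fun h => h.mul_left _⟩
  · intro b
    rw [Set.pair_comm, Ideal.mem_span_insert]
    constructor
    · rintro ⟨c, d, hd, rfl⟩
      exact ⟨c, by rwa [mul_comm, add_sub_cancel_left]⟩
    · rintro ⟨c, hc⟩
      exact ⟨c, _, hc, by ring⟩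
  · have := hmul (z ^ (n - 1)) (n - 1) (by omega) rfl
    rwa [show n - (n - 1) = 1 by omega, pow_one] at this
  · rw [hZ]
    rintro ⟨c, hc⟩
    obtain ⟨q, hq⟩ := hgen c
    have h1 : aeval z (1 - X * q) ∈ Ideal.span {u, v} := by
      have := add_mem hc (Ideal.mul_mem_left _ z hq)
      rw [map_sub, map_mul, aeval_X, map_one]
      convert this using 1
      ring
    have h2 := X_dvd_iff.1 ((dvd_pow_self X hn.ne').trans (hind _ h1))
    simp at h2
  · intro b
    obtain ⟨q, hq⟩ := hgen b
    refine ⟨q.coeff 0, (hZ _ _).2 ⟨aeval z q.divX, ?_⟩⟩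
    convert hq using 1
    conv_rhs => rw [← X_mul_divX_add q]
    rw [map_add, map_mul, aeval_X, aeval_C]
    ring
  · rw [map_pow, hgz, _root_.smul_pow, hζ]

/-- If every element of `A` can be written uniquely as `∑ p_i(u, v) z^i` with `i < n`,
for polynomials `p_i`, and `z^n` lies in the ideal `(u, v)`, then an automorphism of `A` which maps
`u, v, z` to `μ u, ν v, ζ z` with `ζ^(n-1) = μ ν` has homological determinant `1`. -/
theorem isHdet_one_of_free {u v z : A} {n : ℕ} (hn : 0 < n)
    (hfree : Function.Bijective fun P : Fin n → MvPolynomial (Fin 2) k =>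
      ∑ i, MvPolynomial.aeval ![u, v] (P i) * z ^ (i : ℕ))
    (hz : z ^ n ∈ Ideal.span {u, v})
    (g : A ≃ₐ[k] A) {I : Ideal A} (hI : I = Ideal.span {z, u, v}) (hg : ∀ b ∈ I, g b ∈ I)
    {μ ν ζ : k} (hgu : g u = μ • u) (hgv : g v = ν • v) (hgz : g z = ζ • z)
    (hζ : ζ ^ (n - 1) = μ * ν) : IsHdet I g hg 1 := by
  set Φ := fun P : Fin n → MvPolynomial (Fin 2) k =>
      ∑ i, MvPolynomial.aeval ![u, v] (P i) * z ^ (i : ℕ) with hΦ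
  have hu : ∀ P, u * Φ P = Φ fun i => MvPolynomial.X 0 * P i := fun P => by
    simp [hΦ, Finset.mul_sum, mul_assoc]
  have hv : ∀ P, v * Φ P = Φ fun i => MvPolynomial.X 1 * P i := fun P => by
    simp [hΦ, Finset.mul_sum, mul_assoc]
  refine isHdet_one_of_regular hn ?_ ?_ hz ?_ ?_ g hI hg hgu hgv hgz hζ
  · intro b hb
    obtain ⟨P, rfl⟩ := hfree.2 b
    have h0 : Φ 0 = 0 := by simp [hΦ]
    have := hfree.1 ((hu P).symm.trans (hb.trans h0.symm))
    rw [show P = 0 from funext fun i => by simpa [MvPolynomial.X_ne_zero] using congrFun this i]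
    exact h0
  · intro b c hbc
    obtain ⟨P, rfl⟩ := hfree.2 b
    obtain ⟨Q, rfl⟩ := hfree.2 c
    have := hfree.1 ((hv P).symm.trans (hbc.trans (hu Q)))
    have hd : ∀ i, ∃ d, P i = MvPolynomial.X 0 * d := fun i => by
      have h1 : (MvPolynomial.X 0 : MvPolynomial (Fin 2) k) ∣ MvPolynomial.X 1 * P i :=
        ⟨Q i, congrFun this i⟩
      rcases MvPolynomial.X_dvd_mul_iff.1 h1 with h2 | h2
      · simp [MvPolynomial.X_dvd_X] at h2
      · exact h2
    choose d hd using hd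
    exact ⟨Φ d, by rw [hu]; exact congrArg Φ (funext hd)⟩
  · intro b
    obtain ⟨P, rfl⟩ := hfree.2 b
    refine ⟨∑ i : Fin n, monomial (i : ℕ) (MvPolynomial.constantCoeff (P i)), ?_⟩
    rw [map_sum, hΦ, ← Finset.sum_sub_distrib]
    refine Ideal.sum_mem _ fun i _ => ?_
    rw [aeval_monomial, ← sub_mul]
    refine Ideal.mul_mem_right _ _ ?_
    induction P i using MvPolynomial.induction_on with
    | C c => simp
    | add p q hp hq =>
      have := add_mem hp hq
      convert this using 1
      simp only [map_add]
      ring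
    | mul_X p j _ =>
      simp only [map_mul, MvPolynomial.aeval_X, MvPolynomial.constantCoeff_X, mul_zero, map_zero,
        sub_zero]
      refine Ideal.mul_mem_left _ _ (Ideal.subset_span ?_)
      fin_cases j <;> simp
  · intro q hq
    have h1 : aeval z (q %ₘ X ^ n) ∈ Ideal.span {u, v} := by
      have := sub_mem hq (Ideal.mul_mem_right (aeval z (q /ₘ X ^ n)) _ hz)
      convert this using 1
      nth_rewrite 2 [← modByMonic_add_div q (X ^ n)]
      simp
    obtain ⟨b, c, hbc⟩ := Ideal.mem_span_pair.1 h1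
    obtain ⟨P, rfl⟩ := hfree.2 b
    obtain ⟨Q, rfl⟩ := hfree.2 c
    have h2 : aeval z (q %ₘ X ^ n) = Φ fun i => MvPolynomial.C ((q %ₘ X ^ n).coeff i) := by
      rw [hΦ, aeval_eq_sum_range' (n := n)]
      · simp [Finset.sum_range, Algebra.smul_def]
      · by_cases h : (q %ₘ X ^ n) = 0
        · simpa [h] using hn
        · rw [natDegree_lt_iff_degree_lt h, ← degree_X_pow (R := k)]
          exact degree_modByMonic_lt _ (monic_X_pow n)
    have h3 : Φ P * u + Φ Q * v = Φ fun i => MvPolynomial.X 0 * P i + MvPolynomial.X 1 * Q i := by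
      rw [mul_comm, mul_comm (Φ Q), hu, hv, hΦ, ← Finset.sum_add_distrib]
      refine Finset.sum_congr rfl fun i _ => ?_
      rw [map_add, add_mul]
    have h4 := hfree.1 (h3.symm.trans (hbc.trans h2))
    rw [← modByMonic_eq_zero_iff_dvd (monic_X_pow n)]
    ext i
    by_cases hi : i < n
    · have := congrArg MvPolynomial.constantCoeff (congrFun h4 ⟨i, hi⟩)
      simpa using this.symm
    · refine (coeff_eq_zero_of_degree_lt ((degree_modByMonic_lt _ (monic_X_pow n)).trans_le ?_)).trans
        (coeff_zero i).symm
      rw [degree_X_pow]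
      exact_mod_cast not_lt.1 hi

/-- The automorphism `X₀ ↦ X₀ + t X₁, X₁ ↦ X₀ - t X₁` of the polynomial ring in two variables. -/
noncomputable def planeRotation {t : k} (ht : t ≠ 0) (h2 : (2 : k) ≠ 0) :
    MvPolynomial (Fin 2) k ≃ₐ[k] MvPolynomial (Fin 2) k :=
  AlgEquiv.ofAlgHom
    (MvPolynomial.aeval ![MvPolynomial.X 0 + t • MvPolynomial.X 1,
      MvPolynomial.X 0 - t • MvPolynomial.X 1])
    (MvPolynomial.aeval ![(2⁻¹ : k) • (MvPolynomial.X 0 + MvPolynomial.X 1),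
      (2 * t : k)⁻¹ • (MvPolynomial.X 0 - MvPolynomial.X 1)])
    (by
      refine MvPolynomial.algHom_ext fun i => ?_
      fin_cases i <;> simp only [AlgHom.comp_apply, MvPolynomial.aeval_X, map_smul, map_add, map_sub,
        AlgHom.id_apply, Matrix.cons_val_zero, Matrix.cons_val_one, Fin.zero_eta, Fin.mk_one] <;>
        match_scalars <;> field_simp <;> ring)
    (by
      refine MvPolynomial.algHom_ext fun i => ?_
      fin_cases i <;> simp only [AlgHom.comp_apply, MvPolynomial.aeval_X, map_smul, map_add, map_sub,
        AlgHom.id_apply, Matrix.cons_val_zero, Matrix.cons_val_one, Fin.zero_eta, Fin.mk_one] <;>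
        match_scalars <;> field_simp <;> ring)

theorem bijective_planeRotation {x y z : A} {n : ℕ} {t : k} (ht : t ≠ 0) (h2 : (2 : k) ≠ 0)
    (hfree : Function.Bijective fun P : Fin n → MvPolynomial (Fin 2) k =>
      ∑ i, MvPolynomial.aeval ![x, y] (P i) * z ^ (i : ℕ)) :
    Function.Bijective fun P : Fin n → MvPolynomial (Fin 2) k =>
      ∑ i, MvPolynomial.aeval ![x + t • y, x - t • y] (P i) * z ^ (i : ℕ) := by
  have h : (MvPolynomial.aeval ![x, y]).comp
      (planeRotation ht h2 : MvPolynomial (Fin 2) k →ₐ[k] MvPolynomial (Fin 2) k) =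
        MvPolynomial.aeval (R := k) ![x + t • y, x - t • y] := by
    refine MvPolynomial.algHom_ext fun i => ?_
    fin_cases i <;> simp [planeRotation]
  rw [← h]
  exact hfree.comp (planeRotation ht h2).bijective.comp_left

theorem span_planeRotation {x y : A} {t : k} (ht : t ≠ 0) (h2 : (2 : k) ≠ 0) :
    Ideal.span {x + t • y, x - t • y} = Ideal.span {x, y} := by
  refine le_antisymm (Ideal.span_le.2 ?_) (Ideal.span_le.2 ?_)
  · rintro _ (rfl | rfl)
    · exact Ideal.mem_span_pair.2 ⟨1, algebraMap k A t, by rw [Algebra.smul_def, one_mul]⟩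
    · exact Ideal.mem_span_pair.2 ⟨1, -algebraMap k A t, by rw [Algebra.smul_def]; ring⟩
  · rintro _ (rfl | rfl)
    · refine Ideal.mem_span_pair.2 ⟨algebraMap k A 2⁻¹, algebraMap k A 2⁻¹, ?_⟩
      simp only [← Algebra.smul_def]
      match_scalars <;> field_simp <;> ring
    · refine Ideal.mem_span_pair.2
        ⟨algebraMap k A (2 * t)⁻¹, -algebraMap k A (2 * t)⁻¹, ?_⟩
      simp only [neg_mul, ← Algebra.smul_def]
      match_scalars <;> field_simp <;> ring

/-- Suppose that every element of `A` can be written uniquely as `∑ p_i(x, y) z^i` with `i < n`,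
for polynomials `p_i`, and that `z^n` lies in the ideal `(x, y)`. Then the automorphisms
`x ↦ p x, y ↦ p⁻¹ y, z ↦ z` of `A` have homological determinant `1`. -/
theorem isHdet_one_of_diagonal {x y z : A} {n : ℕ} (hn : 0 < n)
    (hfree : Function.Bijective fun P : Fin n → MvPolynomial (Fin 2) k =>
      ∑ i, MvPolynomial.aeval ![x, y] (P i) * z ^ (i : ℕ))
    (hz : z ^ n ∈ Ideal.span {x, y})
    (g : A ≃ₐ[k] A) {I : Ideal A} (hI : I = Ideal.span {z, x, y}) (hg : ∀ b ∈ I, g b ∈ I)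
    {p r : k} (hpr : p * r = 1) (hgx : g x = p • x) (hgy : g y = r • y) (hgz : g z = z) :
    IsHdet I g hg 1 :=
  isHdet_one_of_free hn hfree hz g hI hg hgx hgy (hgz.trans (one_smul k z).symm)
    (by rw [one_pow, hpr])

/-- In the situation of `isHdet_one_of_diagonal`, so have the automorphisms
`x ↦ q y, y ↦ r x, z ↦ -z` with `q r = (-1)^n`. -/
theorem isHdet_one_of_antidiagonal [IsAlgClosed k] (h2 : (2 : k) ≠ 0) {x y z : A} {n : ℕ}
    (hn : 0 < n) (hfree : Function.Bijective fun P : Fin n → MvPolynomial (Fin 2) k =>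
      ∑ i, MvPolynomial.aeval ![x, y] (P i) * z ^ (i : ℕ))
    (hz : z ^ n ∈ Ideal.span {x, y})
    (g : A ≃ₐ[k] A) {I : Ideal A} (hI : I = Ideal.span {z, x, y}) (hg : ∀ b ∈ I, g b ∈ I)
    {q r : k} (hqr : q * r = (-1) ^ n) (hgx : g x = q • y) (hgy : g y = r • x) (hgz : g z = -z) :
    IsHdet I g hg 1 := by
  have hqr0 : q * r ≠ 0 := by rw [hqr]; exact pow_ne_zero _ (neg_ne_zero.2 one_ne_zero)
  have hq : q ≠ 0 := left_ne_zero_of_mul hqr0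
  have hr : r ≠ 0 := right_ne_zero_of_mul hqr0
  obtain ⟨t, ht⟩ := IsAlgClosed.exists_pow_nat_eq (q / r) (n := 2) (by norm_num)
  have ht0 : t ≠ 0 := by
    rintro rfl
    exact div_ne_zero hq hr (by rw [← ht]; simp)
  have htq : r * t * t = q := by
    rw [mul_assoc, ← sq, ht]
    field_simp
  refine isHdet_one_of_free hn (bijective_planeRotation ht0 h2 hfree)
    (by rwa [span_planeRotation ht0 h2]) g ?_ hg (μ := r * t) (ν := -(r * t)) (ζ := -1) ?_ ?_ ?_ ?_
  · rw [hI, Ideal.span_insert, Ideal.span_insert z, span_planeRotation ht0 h2]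
  · rw [map_add, map_smul, hgx, hgy, ← htq]
    module
  · rw [map_sub, map_smul, hgx, hgy, ← htq]
    module
  · rw [hgz, neg_one_smul]
  · obtain ⟨m, rfl⟩ : ∃ m, n = m + 1 := ⟨n - 1, by omega⟩
    rw [Nat.add_sub_cancel]
    linear_combination hqr + r * htq

end FreeOverPlane

/-! ### The representation of a generalized Weyl algebra by skew Laurent polynomials -/

section Representation

universe u v

namespace GWA

variable {k : Type u} [CommRing k] {D : Type v} [CommRing D] [Algebra k D] (σ : D ≃ₐ[k] D) (a : D)

/-- The operator `f ↦ (j ↦ σ(f(j - 1)))`. -/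
def shiftUp : Module.End k (ℤ → D) where
  toFun f j := σ (f (j - 1))
  map_add' _ _ := funext fun _ => map_add σ _ _
  map_smul' c _ := funext fun _ => map_smul σ c _

/-- The operator `f ↦ (j ↦ a σ⁻¹(f(j + 1)))`. -/
def shiftDown : Module.End k (ℤ → D) where
  toFun f j := a * σ.symm (f (j + 1))
  map_add' f g := funext fun j => by simp [mul_add]
  map_smul' c f := funext fun j => by simp

/-- The action of `D[x, y; σ, a]` on the functions `ℤ → D`. -/
noncomputable def rep : GWA k σ a →ₐ[k] Module.End k (ℤ → D) :=
  lift (Algebra.lsmul k k (ℤ → D)) (shiftUp σ) (shiftDown σ a)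
    (LinearMap.ext fun f => funext fun j => by simp [shiftUp, shiftDown])
    (LinearMap.ext fun f => funext fun j => by simp [shiftUp, shiftDown])
    (fun d => LinearMap.ext fun f => funext fun j => by simp [shiftUp])
    (fun d => LinearMap.ext fun f => funext fun j => by
      simp only [shiftDown, Module.End.mul_apply, LinearMap.coe_mk, AddHom.coe_mk,
        Algebra.lsmul_coe, Pi.smul_apply, smul_eq_mul, map_mul]
      ring)

/-- The coefficients of the image of an element of `D[x, y; σ, a]` in `D[x, x⁻¹; σ]`, where
`y ↦ a x⁻¹`. -/
noncomputable def laurentCoeff : GWA k σ a →ₗ[k] ℤ → D :=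
  (LinearMap.applyₗ (Pi.single 0 1)).comp (rep σ a).toLinearMap

theorem laurentCoeff_one : laurentCoeff σ a 1 = Pi.single 0 1 := by
  simp [laurentCoeff]

theorem laurentCoeff_x_mul (r : GWA k σ a) (j : ℤ) :
    laurentCoeff σ a (x σ a * r) j = σ (laurentCoeff σ a r (j - 1)) := by
  simp [laurentCoeff, rep, shiftUp]

theorem laurentCoeff_y_mul (r : GWA k σ a) (j : ℤ) :
    laurentCoeff σ a (y σ a * r) j = a * σ.symm (laurentCoeff σ a r (j + 1)) := by
  simp [laurentCoeff, rep, shiftDown]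

theorem laurentCoeff_coeff_mul (d : D) (r : GWA k σ a) (j : ℤ) :
    laurentCoeff σ a (coeff σ a d * r) j = d * laurentCoeff σ a r j := by
  simp [laurentCoeff, rep]

theorem laurentCoeff_x_mul_single {r : GWA k σ a} {j : ℤ} {d : D}
    (h : laurentCoeff σ a r = Pi.single j d) :
    laurentCoeff σ a (x σ a * r) = Pi.single (j + 1) (σ d) := by
  funext i
  rw [laurentCoeff_x_mul, h]
  by_cases hi : i = j + 1
  · subst hi; simp
  · rw [Pi.single_eq_of_ne hi, Pi.single_eq_of_ne (by omega), map_zero]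

theorem laurentCoeff_y_mul_single {r : GWA k σ a} {j : ℤ} {d : D}
    (h : laurentCoeff σ a r = Pi.single j d) :
    laurentCoeff σ a (y σ a * r) = Pi.single (j - 1) (a * σ.symm d) := by
  funext i
  rw [laurentCoeff_y_mul, h]
  by_cases hi : i = j - 1
  · subst hi; simp
  · rw [Pi.single_eq_of_ne hi, Pi.single_eq_of_ne (by omega), map_zero, mul_zero]

theorem laurentCoeff_coeff (d : D) : laurentCoeff σ a (coeff σ a d) = Pi.single 0 d := by
  funext i
  rw [← mul_one (coeff σ a d), laurentCoeff_coeff_mul, laurentCoeff_one]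
  by_cases hi : i = 0
  · subst hi; simp
  · rw [Pi.single_eq_of_ne hi, Pi.single_eq_of_ne hi, mul_zero]

theorem laurentCoeff_x : laurentCoeff σ a (x σ a) = Pi.single 1 1 := by
  rw [← mul_one (x σ a), laurentCoeff_x_mul_single σ a (laurentCoeff_one σ a)]
  simp

theorem laurentCoeff_y : laurentCoeff σ a (y σ a) = Pi.single (-1) a := by
  rw [← mul_one (y σ a), laurentCoeff_y_mul_single σ a (laurentCoeff_one σ a)]
  simp

end GWA

end Representation

/-! ### The standard filtration of a classical generalized Weyl algebra -/

section StandardFiltration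

universe u

namespace ClassicalGWA

variable {k : Type u} [Field k]

theorem shiftAut_apply (α : k) (p : k[X]) : shiftAut α p = taylor (-α) p := by
  simp [taylor_apply, Polynomial.comp_eq_aeval]

theorem shiftAut_symm_apply (α : k) (p : k[X]) : (shiftAut α).symm p = taylor α p := by
  rw [AlgEquiv.symm_apply_eq, shiftAut_apply, taylor_taylor]
  simp

theorem coeff_taylor_eq_zero (c : k) {p : k[X]} {i : ℕ} (h : ∀ l, i ≤ l → p.coeff l = 0) :
    (taylor c p).coeff i = 0 := by
  refine coeff_eq_zero_of_degree_lt ?_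
  rw [degree_taylor]
  exact (degree_lt_iff_coeff_zero _ _).2 h

theorem coeff_taylor_of_natDegree_le (c : k) {p : k[X]} {i : ℕ} (h : p.natDegree ≤ i) :
    (taylor c p).coeff i = p.coeff i := by
  rcases h.lt_or_eq with h | rfl
  · rw [coeff_eq_zero_of_natDegree_lt (by rwa [natDegree_taylor]), coeff_eq_zero_of_natDegree_lt h]
  · exact coeff_taylor_natDegree c p

theorem leadingCoeff_taylor (c : k) (p : k[X]) : (taylor c p).leadingCoeff = p.leadingCoeff := by
  rw [leadingCoeff, natDegree_taylor, coeff_taylor_natDegree]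

theorem degree_taylor_sub_lt (c : k) {p : k[X]} (hp : p ≠ 0) : (taylor c p - p).degree < p.degree :=
  (degree_sub_lt_left (degree_taylor p c) (by simpa using hp) (leadingCoeff_taylor c p)).trans_eq
    (degree_taylor p c)

variable (α : k) (a : k[X])

theorem word_mem_stdFiltration (w : List (Fin 3)) {m : ℕ} (h : (w.map (genDeg a)).sum ≤ m) :
    (w.map (gen α a)).prod ∈ stdFiltration α a m := Submodule.subset_span ⟨w, h, rfl⟩

theorem gen_mem_stdFiltration (i : Fin 3) : gen α a i ∈ stdFiltration α a (genDeg a i) := by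
  simpa using word_mem_stdFiltration α a [i] (m := genDeg a i) (by simp)

theorem coeff_mem_stdFiltration {p : k[X]} {m : ℕ} (h : 2 * p.natDegree ≤ m) :
    GWA.coeff (shiftAut α) a p ∈ stdFiltration α a m := by
  rw [p.as_sum_range, map_sum]
  refine Submodule.sum_mem _ fun i hi => ?_
  rw [← C_mul_X_pow_eq_monomial, ← smul_eq_C_mul, map_smul, map_pow]
  refine Submodule.smul_mem _ _ (Submodule.subset_span ⟨List.replicate i 2, ?_, ?_⟩)
  · rw [Finset.mem_range] at hi
    simp only [List.map_replicate, genDeg, Matrix.cons_val, List.sum_replicate, smul_eq_mul]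
    omega
  · simp [gen]

theorem filtLT_of_mem {R : Type*} [Ring R] [Algebra k R] {F : ℕ → Submodule k R} {i j : ℕ} {r : R}
    (hr : r ∈ F i) (h : i < j) : r ∈ filtLT F j :=
  (le_iSup₂_of_le (f := fun j' (_ : j' < j) => F j') i h le_rfl) hr

theorem coeff_mem_filtLT {p q : k[X]} {m : ℕ} (h : p.degree < q.degree) (h' : 2 * q.natDegree ≤ m) :
    GWA.coeff (shiftAut α) a p ∈ filtLT (stdFiltration α a) m := by
  rcases eq_or_ne p 0 with rfl | hp
  · simp
  · have := natDegree_lt_natDegree hp h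
    exact filtLT_of_mem (coeff_mem_stdFiltration α a le_rfl) (by omega)

theorem laurentCoeff_gen_mul (g : Fin 3) {r : ClassicalGWA α a} {m : ℕ}
    (hr : ∀ (j : ℤ) (i : ℕ), (m : ℤ) < 2 * i + a.natDegree * j →
      (GWA.laurentCoeff (shiftAut α) a r j).coeff i = 0) (j : ℤ) (i : ℕ)
    (h : ((genDeg a g + m : ℕ) : ℤ) < 2 * i + a.natDegree * j) :
    (GWA.laurentCoeff (shiftAut α) a (gen α a g * r) j).coeff i = 0 := by
  fin_cases g
  · have e : gen α a 0 = GWA.x (shiftAut α) a := rfl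
    have e' : genDeg a 0 = a.natDegree := rfl
    simp only [Fin.zero_eta, e, e', Nat.cast_add] at h ⊢
    rw [GWA.laurentCoeff_x_mul, shiftAut_apply]
    refine coeff_taylor_eq_zero _ fun l hl => hr _ _ ?_
    have : (i : ℤ) ≤ l := by exact_mod_cast hl
    linarith
  · have e : gen α a 1 = GWA.y (shiftAut α) a := rfl
    have e' : genDeg a 1 = a.natDegree := rfl
    simp only [Fin.mk_one, e, e', Nat.cast_add] at h ⊢
    rw [GWA.laurentCoeff_y_mul, shiftAut_symm_apply, coeff_mul]
    refine Finset.sum_eq_zero fun st hst => ?_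
    rw [Finset.HasAntidiagonal.mem_antidiagonal] at hst
    rcases lt_or_ge a.natDegree st.1 with hs | hs
    · rw [coeff_eq_zero_of_natDegree_lt hs, zero_mul]
    · rw [coeff_taylor_eq_zero, mul_zero]
      intro l hl
      refine hr _ _ ?_
      have h1 : (st.2 : ℤ) ≤ l := by exact_mod_cast hl
      have h2 : (st.1 : ℤ) ≤ a.natDegree := by exact_mod_cast hs
      have h3 : (st.1 : ℤ) + st.2 = i := by exact_mod_cast hst
      linarith
  · have e : gen α a 2 = GWA.coeff (shiftAut α) a X := rfl
    have e' : genDeg a 2 = 2 := rfl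
    simp only [Fin.reduceFinMk, e, e', Nat.cast_add] at h ⊢
    rw [GWA.laurentCoeff_coeff_mul]
    rcases i with _ | i
    · simp
    · rw [coeff_X_mul]
      refine hr _ _ ?_
      push_cast at h
      linarith

/-- An element of degree `m` has coefficients of degree at most `(m - n j) / 2`. -/
theorem coeff_laurentCoeff_eq_zero {m : ℕ} {r : ClassicalGWA α a} (hr : r ∈ stdFiltration α a m)
    (j : ℤ) (i : ℕ) (h : (m : ℤ) < 2 * i + a.natDegree * j) :
    (GWA.laurentCoeff (shiftAut α) a r j).coeff i = 0 := by
  induction hr using Submodule.span_induction with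
  | zero => simp
  | add r s _ _ hr hs => simp [hr, hs]
  | smul c r _ hr => simp [hr]
  | mem r hr =>
    obtain ⟨w, hw, rfl⟩ := hr
    have key : ∀ (w : List (Fin 3)) (j : ℤ) (i : ℕ),
        (((w.map (genDeg a)).sum : ℕ) : ℤ) < 2 * i + a.natDegree * j →
        (GWA.laurentCoeff (shiftAut α) a (w.map (gen α a)).prod j).coeff i = 0 := by
      intro w
      induction w with
      | nil =>
        intro j i h
        rw [List.map_nil, List.prod_nil, GWA.laurentCoeff_one]
        by_cases hj : j = 0
        · subst hj
          rw [Pi.single_eq_same, coeff_one, if_neg]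
          rintro rfl
          simp at h
        · rw [Pi.single_eq_of_ne hj, coeff_zero]
      | cons g w ih =>
        intro j i h
        rw [List.map_cons, List.prod_cons]
        exact laurentCoeff_gen_mul α a g ih j i (by simpa using h)
    exact key w j i (lt_of_le_of_lt (by exact_mod_cast hw) h)

/-- The image of the monomial `x^p y^q z^i` in the skew Laurent polynomials. -/
theorem laurentCoeff_monomial (p q i : ℕ) : ∃ d : k[X], d.natDegree ≤ a.natDegree * q + i ∧
    d.coeff (a.natDegree * q + i) = a.leadingCoeff ^ q ∧
    GWA.laurentCoeff (shiftAut α) a (gen α a 0 ^ p * (gen α a 1 ^ q * gen α a 2 ^ i)) =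
      Pi.single ((p : ℤ) - q) d := by
  induction p with
  | zero =>
    induction q with
    | zero =>
      refine ⟨X ^ i, by simp, by simp, ?_⟩
      have : gen α a 2 = GWA.coeff (shiftAut α) a X := rfl
      simp only [pow_zero, one_mul, this, ← map_pow, GWA.laurentCoeff_coeff]
      simp
    | succ q ih =>
      obtain ⟨d, h1, h2, h3⟩ := ih
      refine ⟨a * (shiftAut α).symm d, ?_, ?_, ?_⟩
      · refine natDegree_mul_le.trans ?_
        rw [shiftAut_symm_apply, natDegree_taylor, mul_add, mul_one]
        omega
      · rw [show a.natDegree * (q + 1) + i = a.natDegree + (a.natDegree * q + i) by ring,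
          coeff_mul_add_eq_of_natDegree_le le_rfl (by rw [shiftAut_symm_apply, natDegree_taylor]; exact h1),
          shiftAut_symm_apply, pow_succ', ← h2, coeff_taylor_of_natDegree_le _ h1, coeff_natDegree]
      · rw [pow_zero, one_mul] at h3 ⊢
        rw [pow_succ', mul_assoc]
        refine (GWA.laurentCoeff_y_mul_single (shiftAut α) a h3).trans ?_
        congr 1
        push_cast
        ring
  | succ p ih =>
    obtain ⟨d, h1, h2, h3⟩ := ih
    refine ⟨shiftAut α d, by rwa [shiftAut_apply, natDegree_taylor], ?_, ?_⟩
    · rw [shiftAut_apply, ← h2, coeff_taylor_of_natDegree_le _ h1]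
    · rw [pow_succ', mul_assoc]
      refine (GWA.laurentCoeff_x_mul_single (shiftAut α) a h3).trans ?_
      congr 1
      push_cast
      ring

end ClassicalGWA

end StandardFiltration

/-! ### Principal symbols -/

section Symbol

universe u v

variable {k : Type u} [Field k] {R : Type v} [Ring R] [Algebra k R] (F : ℕ → Submodule k R)

open Classical in
/-- The principal symbol of degree `m` of an element of `F_m` (and `0` outside of `F_m`). -/
noncomputable def grSymbol (m : ℕ) (r : R) : AssocGraded F :=
  if h : r ∈ F m then DirectSum.of (grPiece F) m (grMk F m ⟨r, h⟩) else 0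

variable {F}

theorem grSymbol_of_mem {m : ℕ} {r : R} (h : r ∈ F m) :
    grSymbol F m r = DirectSum.of (grPiece F) m (grMk F m ⟨r, h⟩) := dif_pos h

theorem grSymbol_add {m : ℕ} {r s : R} (hr : r ∈ F m) (hs : s ∈ F m) :
    grSymbol F m (r + s) = grSymbol F m r + grSymbol F m s := by
  rw [grSymbol_of_mem hr, grSymbol_of_mem hs, grSymbol_of_mem (add_mem hr hs), ← map_add,
    ← map_add]
  rfl

theorem grSymbol_zero (m : ℕ) : grSymbol F m 0 = 0 := by
  rw [grSymbol_of_mem (zero_mem _)]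
  exact (congrArg _ (map_zero (grMk F m))).trans (map_zero _)

theorem grSymbol_eq_zero {m : ℕ} {r : R} (hr : r ∈ filtLT F m) : grSymbol F m r = 0 := by
  by_cases h : r ∈ F m
  · rw [grSymbol_of_mem h, (grMk_eq_zero _).2 hr, map_zero]
  · exact dif_neg h

theorem grSymbol_congr {m : ℕ} {r s : R} (hr : r ∈ F m) (hs : s ∈ F m)
    (h : r - s ∈ filtLT F m) : grSymbol F m r = grSymbol F m s := by
  have h' := grSymbol_add (sub_mem hr hs) hs
  rwa [sub_add_cancel, grSymbol_eq_zero h, zero_add] at h'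

theorem assocGraded_induction {P : AssocGraded F → Prop} (hadd : ∀ b c, P b → P c → P (b + c))
    (hsymb : ∀ m, ∀ r ∈ F m, P (grSymbol F m r)) (b : AssocGraded F) : P b := by
  induction b using DirectSum.induction_on with
  | zero =>
    rw [← grSymbol_zero 0]
    exact hsymb 0 0 (zero_mem _)
  | of m r =>
    obtain ⟨r, rfl⟩ := grMk_surjective _ r
    rw [← grSymbol_of_mem r.2]
    exact hsymb m r r.2
  | add b c hb hc => exact hadd b c hb hc

theorem grSymbol_smul {m : ℕ} (c : k) {r : R} (hr : r ∈ F m) :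
    grSymbol F m (c • r) = c • grSymbol F m r := by
  rw [grSymbol_of_mem hr, grSymbol_of_mem (Submodule.smul_mem _ c hr)]
  exact (congrArg _ (map_smul (grMk F m) c ⟨r, hr⟩)).trans
    (map_smul (DirectSum.lof k ℕ (grPiece F) m) c _)

/-- The linear functional on `F_m / F_{<m}` given by a linear functional on `R` which vanishes on
`F_{<m}`. -/
def grPieceFunctional (m : ℕ) (f : R →ₗ[k] k) (hf : ∀ r ∈ filtLT F m, f r = 0) :
    grPiece F m →ₗ[k] k :=
  Submodule.liftQ ((filtLT F m).submoduleOf (F m)) (f.comp (F m).subtype) fun r hr => hf r hr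

/-- The linear functional on `gr R` given by a linear functional on `R` which vanishes on
`F_{<m}`. -/
def grFunctional (m : ℕ) (f : R →ₗ[k] k) (hf : ∀ r ∈ filtLT F m, f r = 0) :
    AssocGraded F →ₗ[k] k :=
  (grPieceFunctional m f hf).comp (DirectSum.component k ℕ (grPiece F) m)

theorem grFunctional_grSymbol {m : ℕ} {f : R →ₗ[k] k} (hf : ∀ r ∈ filtLT F m, f r = 0) {r : R}
    (hr : r ∈ F m) : grFunctional m f hf (grSymbol F m r) = f r := by
  rw [grSymbol_of_mem hr, grFunctional, LinearMap.comp_apply]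
  exact congrArg (grPieceFunctional m f hf)
    (DirectSum.of_eq_same m (grMk F m ⟨r, hr⟩) :
      DirectSum.component k ℕ (grPiece F) m (DirectSum.of (grPiece F) m _) = _)

theorem grFunctional_grSymbol_of_ne {m : ℕ} {f : R →ₗ[k] k} (hf : ∀ r ∈ filtLT F m, f r = 0)
    {m' : ℕ} (h : m' ≠ m) (r : R) : grFunctional m f hf (grSymbol F m' r) = 0 := by
  by_cases hr : r ∈ F m'
  · rw [grSymbol_of_mem hr, grFunctional, LinearMap.comp_apply]
    exact (congrArg (grPieceFunctional m f hf)
      (DirectSum.of_eq_of_ne m' m (grMk F m' ⟨r, hr⟩) h.symm :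
        DirectSum.component k ℕ (grPiece F) m (DirectSum.of (grPiece F) m' _) = 0)).trans
      (map_zero _)
  · rw [grSymbol, dif_neg hr, map_zero]

variable [IsRingFiltration F (filtLT F)]

theorem grSymbol_mul {i j : ℕ} {r s : R} (hr : r ∈ F i) (hs : s ∈ F j) :
    grSymbol F i r * grSymbol F j s = grSymbol F (i + j) (r * s) := by
  rw [grSymbol_of_mem hr, grSymbol_of_mem hs,
    grSymbol_of_mem (SetLike.GradedMul.mul_mem hr hs : r * s ∈ F (i + j))]
  exact DirectSum.of_mul_of _ _

theorem grSymbol_one : grSymbol F 0 1 = 1 := grSymbol_of_mem _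

theorem one_mem_filtration : (1 : R) ∈ F 0 := SetLike.GradedOne.one_mem

theorem grSymbol_pow {i : ℕ} {r : R} (hr : r ∈ F i) (m : ℕ) :
    grSymbol F i r ^ m = grSymbol F (m * i) (r ^ m) ∧ r ^ m ∈ F (m * i) := by
  induction m with
  | zero => simpa using ⟨grSymbol_one.symm, one_mem_filtration⟩
  | succ m ih =>
    rw [pow_succ, ih.1, grSymbol_mul ih.2 hr, pow_succ, Nat.succ_mul]
    exact ⟨rfl, SetLike.GradedMul.mul_mem ih.2 hr⟩

theorem grSymbol_list_prod {ι : Type*} (d : ι → ℕ) (x : ι → R) (h : ∀ i, x i ∈ F (d i))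
    (w : List ι) : (w.map fun i => grSymbol F (d i) (x i)).prod =
      grSymbol F (w.map d).sum (w.map x).prod ∧ (w.map x).prod ∈ F (w.map d).sum := by
  induction w with
  | nil => simpa using ⟨grSymbol_one.symm, one_mem_filtration⟩
  | cons i w ih =>
    simp only [List.map_cons, List.prod_cons, List.sum_cons]
    rw [ih.1, grSymbol_mul (h i) ih.2]
    exact ⟨rfl, SetLike.GradedMul.mul_mem (h i) ih.2⟩

theorem grAut_grSymbol (g : filteredAut F) {m : ℕ} {r : R} (hr : r ∈ F m) :
    grAut g (grSymbol F m r) = grSymbol F m ((g : R ≃ₐ[k] R) r) := by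
  rw [grSymbol_of_mem hr, grSymbol_of_mem ((g.2 m r).2 hr)]
  exact grAut_of g m _

theorem assocGraded_mul_comm
    (h : ∀ i j, ∀ r ∈ F i, ∀ s ∈ F j, r * s - s * r ∈ filtLT F (i + j)) (b c : AssocGraded F) :
    b * c = c * b := by
  induction b using assocGraded_induction with
  | hadd b b' hb hb' => rw [add_mul, mul_add, hb, hb']
  | hsymb i r hr =>
    induction c using assocGraded_induction with
    | hadd c c' hc hc' => rw [add_mul, mul_add, hc, hc']
    | hsymb j s hs =>
      have hsr : s * r ∈ F (j + i) := SetLike.GradedMul.mul_mem hs hr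
      rw [grSymbol_mul hr hs, grSymbol_mul hs hr]
      rw [add_comm j i] at hsr ⊢
      exact grSymbol_congr (SetLike.GradedMul.mul_mem hr hs) hsr (h i j r hr s hs)

/-- The associated graded algebra as a commutative ring, if it is commutative. -/
@[reducible] def assocGradedCommRing
    (h : ∀ i j, ∀ r ∈ F i, ∀ s ∈ F j, r * s - s * r ∈ filtLT F (i + j)) :
    CommRing (AssocGraded F) :=
  { (inferInstance : Ring (AssocGraded F)) with mul_comm := assocGraded_mul_comm h }

end Symbol

/-! ### The associated graded algebra of a classical generalized Weyl algebra -/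

section GradedGWA

universe u

namespace ClassicalGWA

variable {k : Type u} [Field k] (α : k) {a : k[X]}

theorem filtLT_mono {R : Type*} [Ring R] [Algebra k R] (F : ℕ → Submodule k R) {i j : ℕ}
    (h : i ≤ j) : filtLT F i ≤ filtLT F j :=
  iSup₂_le fun l hl => le_iSup₂_of_le (f := fun l (_ : l < j) => F l) l (hl.trans_le h) le_rfl

theorem commutator_symm {R : Type*} [Ring R] [Algebra k R] {F : ℕ → Submodule k R} {i j : ℕ}
    {r s : R} (h : r * s - s * r ∈ filtLT F (i + j)) : s * r - r * s ∈ filtLT F (j + i) := by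
  rw [← neg_sub, add_comm]
  exact neg_mem h

theorem gen_commutator (ha : a ≠ 0) (g g' : Fin 3) :
    gen α a g * gen α a g' - gen α a g' * gen α a g ∈
      filtLT (stdFiltration α a) (genDeg a g + genDeg a g') := by
  have hxy : gen α a 0 * gen α a 1 - gen α a 1 * gen α a 0 ∈
      filtLT (stdFiltration α a) (genDeg a 0 + genDeg a 1) := by
    change GWA.x _ a * GWA.y _ a - GWA.y _ a * GWA.x _ a ∈
      filtLT (stdFiltration α a) (a.natDegree + a.natDegree)
    rw [GWA.x_mul_y, GWA.y_mul_x, ← map_sub, shiftAut_apply]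
    exact coeff_mem_filtLT α a (degree_taylor_sub_lt _ ha) (two_mul _).le
  have hz : ∀ (g : Fin 3) (c : k), gen α a g * GWA.coeff _ a X =
      GWA.coeff _ a (X + C c) * gen α a g →
      gen α a g * gen α a 2 - gen α a 2 * gen α a g ∈
        filtLT (stdFiltration α a) (genDeg a g + genDeg a 2) := by
    intro g c h
    change gen α a g * GWA.coeff _ a X - GWA.coeff _ a X * gen α a g ∈
      filtLT (stdFiltration α a) (genDeg a g + 2)
    rw [h, map_add, add_mul, add_sub_cancel_left, ← algebraMap_eq, AlgHom.commutes,
      ← Algebra.smul_def]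
    exact filtLT_of_mem (Submodule.smul_mem _ _ (gen_mem_stdFiltration α a g)) (by omega)
  have hxz := hz 0 (-α) (by
    refine (GWA.x_mul_coeff _ a X).trans ?_
    rw [shiftAut_apply, taylor_X]
    rfl)
  have hyz := hz 1 α (by
    refine (GWA.y_mul_coeff _ a X).trans ?_
    rw [shiftAut_symm_apply, taylor_X]
    rfl)
  fin_cases g <;> fin_cases g'
  · simp
  · exact hxy
  · exact hxz
  · exact commutator_symm hxy
  · simp
  · exact hyz
  · exact commutator_symm hxz
  · exact commutator_symm hyz
  · simp

theorem word_commutator {r : ClassicalGWA α a} {m : ℕ}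
    (h : ∀ g, gen α a g * r - r * gen α a g ∈ filtLT (stdFiltration α a) (genDeg a g + m))
    (w : List (Fin 3)) : (w.map (gen α a)).prod * r - r * (w.map (gen α a)).prod ∈
      filtLT (stdFiltration α a) ((w.map (genDeg a)).sum + m) := by
  induction w with
  | nil => simp
  | cons g w ih =>
    simp only [List.map_cons, List.prod_cons, List.sum_cons]
    have h1 := filtLT_mul_right (gen_mem_stdFiltration α a g) ih
    have h2 := filtLT_mul_left (h g) (word_mem_stdFiltration α a w le_rfl)
    rw [show genDeg a g + m + (w.map (genDeg a)).sum =
      genDeg a g + ((w.map (genDeg a)).sum + m) by ring] at h2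
    rw [add_assoc]
    convert add_mem h1 h2 using 1
    noncomm_ring

/-- The associated graded algebra is commutative. -/
theorem stdFiltration_commutator (ha : a ≠ 0) (i j : ℕ) (r : ClassicalGWA α a)
    (hr : r ∈ stdFiltration α a i) (s : ClassicalGWA α a) (hs : s ∈ stdFiltration α a j) :
    r * s - s * r ∈ filtLT (stdFiltration α a) (i + j) := by
  induction hr using Submodule.span_induction with
  | zero => simp
  | add r r' _ _ h h' =>
    convert add_mem h h' using 1
    noncomm_ring
  | smul c r _ h =>
    convert Submodule.smul_mem _ c h using 1
    rw [smul_mul_assoc, mul_smul_comm, smul_sub]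
  | mem r hr =>
    obtain ⟨w, hw, rfl⟩ := hr
    induction hs using Submodule.span_induction with
    | zero => simp
    | add r r' _ _ h h' =>
      convert add_mem h h' using 1
      noncomm_ring
    | smul c r _ h =>
      convert Submodule.smul_mem _ c h using 1
      rw [smul_mul_assoc, mul_smul_comm, smul_sub]
    | mem s hs =>
      obtain ⟨w', hw', rfl⟩ := hs
      refine filtLT_mono _ (add_le_add hw hw') (word_commutator α
        (fun g => commutator_symm (word_commutator α (fun g' => gen_commutator α ha g' g) w')) w)

/-- The commutative ring structure of the associated graded algebra. -/
noncomputable abbrev grCommRing (ha : a ≠ 0) : CommRing (AssocGraded (stdFiltration α a)) :=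
  assocGradedCommRing (stdFiltration_commutator α ha)

/-- The principal symbols of the generators. -/
noncomputable def grGen (g : Fin 3) : AssocGraded (stdFiltration α a) :=
  grSymbol (stdFiltration α a) (genDeg a g) (gen α a g)

theorem assocGraded_word_induction {P : AssocGraded (stdFiltration α a) → Prop}
    (hzero : P 0) (hadd : ∀ b c, P b → P c → P (b + c)) (hsmul : ∀ (c : k) b, P b → P (c • b))
    (hword : ∀ w : List (Fin 3), P (w.map (grGen α)).prod) (b : AssocGraded (stdFiltration α a)) :
    P b := by
  induction b using assocGraded_induction with
  | hadd b c hb hc => exact hadd b c hb hc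
  | hsymb m r hr =>
    induction hr using Submodule.span_induction with
    | zero => rwa [grSymbol_zero]
    | add r s hr hs h h' =>
      rw [grSymbol_add hr hs]
      exact hadd _ _ h h'
    | smul c r hr h =>
      rw [grSymbol_smul c hr]
      exact hsmul _ _ h
    | mem r hr =>
      obtain ⟨w, hw, rfl⟩ := hr
      rcases hw.lt_or_eq with h | rfl
      · rwa [grSymbol_eq_zero (filtLT_of_mem (word_mem_stdFiltration α a w le_rfl) h)]
      · rw [← (grSymbol_list_prod (genDeg a) (gen α a) (gen_mem_stdFiltration α a) w).1]
        exact hword w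

theorem grSymbol_coeff {p : k[X]} {i : ℕ} (h : p.natDegree ≤ i) :
    grSymbol (stdFiltration α a) (2 * i) (GWA.coeff (shiftAut α) a p) =
      p.coeff i • grGen α 2 ^ i := by
  have hz := grSymbol_pow (gen_mem_stdFiltration α a 2) i
  rw [grGen, hz.1]
  have e : genDeg a 2 = 2 := rfl
  have hz2 := hz.2
  rw [e, mul_comm i 2] at hz2 ⊢
  rw [← grSymbol_smul _ hz2]
  refine grSymbol_congr (coeff_mem_stdFiltration α a (by omega)) (Submodule.smul_mem _ _ hz2) ?_
  have : p.coeff i • gen α a 2 ^ i = GWA.coeff (shiftAut α) a (monomial i (p.coeff i)) := by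
    rw [← C_mul_X_pow_eq_monomial, ← smul_eq_C_mul, map_smul, map_pow]
    rfl
  rw [this, ← map_sub]
  refine coeff_mem_filtLT α a (q := X ^ i) ?_ (by simp)
  rw [degree_X_pow, degree_lt_iff_coeff_zero]
  intro l hl
  rcases hl.lt_or_eq with hl | rfl
  · rw [coeff_sub, coeff_monomial_of_ne _ (by omega),
      coeff_eq_zero_of_natDegree_lt (by omega), sub_zero]
  · simp

theorem grGen_zero_mul_one :
    grGen (a := a) α 0 * grGen α 1 = a.leadingCoeff • grGen α 2 ^ a.natDegree := by
  rw [grGen, grGen, grSymbol_mul (gen_mem_stdFiltration α a 0) (gen_mem_stdFiltration α a 1)]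
  change grSymbol _ (a.natDegree + a.natDegree) (GWA.x _ a * GWA.y _ a) = _
  rw [GWA.x_mul_y, ← two_mul, grSymbol_coeff α (by rw [shiftAut_apply, natDegree_taylor]),
    shiftAut_apply, coeff_taylor_natDegree]

theorem grIrrelevant_eq (ha : 0 < a.natDegree) :
    grIrrelevant (stdFiltration α a) = Ideal.span {grGen α 2, grGen α 0, grGen α 1} := by
  refine le_antisymm (Ideal.span_le.2 ?_) (Ideal.span_le.2 ?_)
  · rintro _ ⟨m, hm, r, rfl⟩
    obtain ⟨⟨r, hr⟩, rfl⟩ := grMk_surjective _ r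
    rw [← grSymbol_of_mem hr, SetLike.mem_coe]
    induction hr using Submodule.span_induction with
    | zero => rw [grSymbol_zero]; exact zero_mem _
    | add r s hr hs h h' => rw [grSymbol_add hr hs]; exact add_mem h h'
    | smul c r hr h =>
      rw [grSymbol_smul c hr, Algebra.smul_def]
      exact Ideal.mul_mem_left _ _ h
    | mem r hr =>
      obtain ⟨w, hw, rfl⟩ := hr
      rcases hw.lt_or_eq with h | rfl
      · rw [grSymbol_eq_zero (filtLT_of_mem (word_mem_stdFiltration α a w le_rfl) h)]
        exact zero_mem _
      · rw [← (grSymbol_list_prod (genDeg a) (gen α a) (gen_mem_stdFiltration α a) w).1]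
        rcases List.eq_nil_or_concat w with rfl | ⟨w, g, rfl⟩
        · simp at hm
        · rw [List.concat_eq_append, List.map_append, List.prod_append, List.map_singleton, List.prod_singleton]
          refine Ideal.mul_mem_left _ _ (Ideal.subset_span ?_)
          change grGen α g ∈ _
          fin_cases g <;> simp
  · have key : ∀ g, grGen (a := a) α g ∈ grIrrelevant (stdFiltration α a) := fun g => by
      rw [grGen, grSymbol_of_mem (gen_mem_stdFiltration α a g)]
      refine Ideal.subset_span ⟨_, ?_, _, rfl⟩
      fin_cases g <;> simp [genDeg, ha]
    rintro _ (rfl | rfl | rfl) <;> exact key _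

theorem surjective_gr_free (ha : 0 < a.natDegree) :
    letI := grCommRing α (ne_zero_of_natDegree_gt ha)
    Function.Surjective fun P : Fin a.natDegree → MvPolynomial (Fin 2) k =>
      ∑ i, MvPolynomial.aeval ![grGen (a := a) α 0, grGen α 1] (P i) * grGen α 2 ^ (i : ℕ) := by
  let := grCommRing α (ne_zero_of_natDegree_gt ha)
  have hc : a.leadingCoeff ≠ 0 := leadingCoeff_ne_zero.2 (ne_zero_of_natDegree_gt ha)
  set Φ := fun P : Fin a.natDegree → MvPolynomial (Fin 2) k =>
      ∑ i, MvPolynomial.aeval ![grGen (a := a) α 0, grGen α 1] (P i) * grGen α 2 ^ (i : ℕ) with hΦ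
  have key : ∀ (i : ℕ) (p : MvPolynomial (Fin 2) k), ∃ P, Φ P =
      MvPolynomial.aeval ![grGen (a := a) α 0, grGen α 1] p * grGen α 2 ^ i := by
    intro i
    induction i using Nat.strong_induction_on with
    | _ i ih =>
      intro p
      rcases lt_or_ge i a.natDegree with hi | hi
      · refine ⟨Pi.single ⟨i, hi⟩ p, ?_⟩
        rw [hΦ]
        refine (Finset.sum_eq_single ⟨i, hi⟩ (fun j _ hj => ?_) (by simp)).trans ?_
        · rw [Pi.single_eq_of_ne hj, map_zero, zero_mul]
        · rw [Pi.single_eq_same]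
      · obtain ⟨P, hP⟩ := ih (i - a.natDegree) (by omega)
          (p * (a.leadingCoeff⁻¹ • (MvPolynomial.X 0 * MvPolynomial.X 1)))
        refine ⟨P, hP.trans ?_⟩
        rw [map_mul, map_smul, map_mul, MvPolynomial.aeval_X, MvPolynomial.aeval_X, mul_assoc]
        congr 1
        have := grGen_zero_mul_one (a := a) α
        change a.leadingCoeff⁻¹ • (grGen (a := a) α 0 * grGen α 1) * _ = _
        rw [this, smul_smul, inv_mul_cancel₀ hc, one_smul, ← pow_add]
        congr 1
        omega
  intro b
  induction b using assocGraded_word_induction with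
  | hzero => exact ⟨0, by simp [hΦ]⟩
  | hadd b c hb hc =>
    obtain ⟨P, rfl⟩ := hb
    obtain ⟨Q, rfl⟩ := hc
    exact ⟨P + Q, by simp [hΦ, add_mul, Finset.sum_add_distrib]⟩
  | hsmul c b hb =>
    obtain ⟨P, rfl⟩ := hb
    exact ⟨c • P, by simp [hΦ, Finset.smul_sum]⟩
  | hword w =>
    suffices ∃ (p : MvPolynomial (Fin 2) k) (i : ℕ), (w.map (grGen α)).prod =
        MvPolynomial.aeval ![grGen (a := a) α 0, grGen α 1] p * grGen α 2 ^ i by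
      obtain ⟨p, i, h⟩ := this
      rw [h]
      exact key i p
    induction w with
    | nil => exact ⟨1, 0, by simp⟩
    | cons g w ih =>
      obtain ⟨p, i, h⟩ := ih
      rw [List.map_cons, List.prod_cons, h]
      fin_cases g
      · exact ⟨MvPolynomial.X 0 * p, i, by simp [mul_assoc]⟩
      · exact ⟨MvPolynomial.X 1 * p, i, by simp [mul_assoc]⟩
      · exact ⟨p, i + 1, by rw [pow_succ']; exact mul_left_comm _ _ _⟩

/-- The coefficient of `z^d` in the `j`-th coefficient of an element of `R`. -/
noncomputable def laurentFunctional (a : k[X]) (j : ℤ) (d : ℕ) : ClassicalGWA α a →ₗ[k] k :=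
  (lcoeff k d).comp ((LinearMap.proj j).comp (GWA.laurentCoeff (shiftAut α) a))

theorem laurentFunctional_filtLT {m : ℕ} {j : ℤ} {d : ℕ} (h : (m : ℤ) ≤ 2 * d + a.natDegree * j) :
    ∀ r ∈ filtLT (stdFiltration α a) m, laurentFunctional α a j d r = 0 := by
  suffices filtLT (stdFiltration α a) m ≤ LinearMap.ker (laurentFunctional α a j d) from this
  refine iSup₂_le fun l hl r hr => coeff_laurentCoeff_eq_zero α a hr j d ?_
  have : (l : ℤ) < m := by exact_mod_cast hl
  linarith

theorem grGen_monomial (p q i : ℕ) :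
    grGen (a := a) α 0 ^ p * (grGen α 1 ^ q * grGen α 2 ^ i) =
      grSymbol (stdFiltration α a) (p * a.natDegree + (q * a.natDegree + i * 2))
        (gen α a 0 ^ p * (gen α a 1 ^ q * gen α a 2 ^ i)) ∧
    gen α a 0 ^ p * (gen α a 1 ^ q * gen α a 2 ^ i) ∈
      stdFiltration α a (p * a.natDegree + (q * a.natDegree + i * 2)) := by
  obtain ⟨hx, hx'⟩ := grSymbol_pow (gen_mem_stdFiltration α a 0) p
  obtain ⟨hy, hy'⟩ := grSymbol_pow (gen_mem_stdFiltration α a 1) q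
  obtain ⟨hz, hz'⟩ := grSymbol_pow (gen_mem_stdFiltration α a 2) i
  have hyz := SetLike.GradedMul.mul_mem hy' hz'
  refine ⟨?_, SetLike.GradedMul.mul_mem hx' hyz⟩
  rw [grGen, grGen, grGen, hx, hy, hz, grSymbol_mul hy' hz', grSymbol_mul hx' hyz]
  rfl

theorem grFunctional_monomial {p₀ q₀ i₀ p q i : ℕ} (hi₀ : i₀ < a.natDegree) (hi : i < a.natDegree)
    (hf : ∀ r ∈ filtLT (stdFiltration α a) (p₀ * a.natDegree + (q₀ * a.natDegree + i₀ * 2)),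
      laurentFunctional α a ((p₀ : ℤ) - q₀) (a.natDegree * q₀ + i₀) r = 0) :
    grFunctional _ _ hf (grGen α 0 ^ p * (grGen α 1 ^ q * grGen α 2 ^ i)) =
      if i = i₀ ∧ p = p₀ ∧ q = q₀ then a.leadingCoeff ^ q₀ else 0 := by
  obtain ⟨h, h'⟩ := grGen_monomial (a := a) α p q i
  obtain ⟨d, -, hd, hd'⟩ := laurentCoeff_monomial α a p q i
  rw [h]
  split_ifs with he
  · obtain ⟨rfl, rfl, rfl⟩ := he
    rw [grFunctional_grSymbol hf h', laurentFunctional, LinearMap.comp_apply, LinearMap.comp_apply,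
      hd', LinearMap.proj_apply, Pi.single_eq_same, lcoeff_apply, hd]
  · rcases ne_or_eq (p * a.natDegree + (q * a.natDegree + i * 2))
      (p₀ * a.natDegree + (q₀ * a.natDegree + i₀ * 2)) with hm | hm
    · exact grFunctional_grSymbol_of_ne hf hm _
    · revert h'
      rw [hm]
      intro h'
      rw [grFunctional_grSymbol hf h', laurentFunctional, LinearMap.comp_apply,
        LinearMap.comp_apply, hd', LinearMap.proj_apply, Pi.single_eq_of_ne, map_zero]
      intro hpq
      refine he ?_
      have h1 : a.natDegree * q + i = a.natDegree * q₀ + i₀ := by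
        zify at hm ⊢
        have : (p : ℤ) = p₀ - q₀ + q := by linarith
        rw [this] at hm
        linarith
      have h2 : i = i₀ := by
        have := congrArg (· % a.natDegree) h1
        simpa [Nat.mul_add_mod, Nat.mod_eq_of_lt hi, Nat.mod_eq_of_lt hi₀] using this
      have h3 : q = q₀ := by
        rw [h2] at h1
        exact Nat.eq_of_mul_eq_mul_left (by omega) (Nat.add_right_cancel h1)
      exact ⟨h2, by omega, h3⟩

/-- The associated graded algebra is free over the polynomial ring in the principal symbols of
`x` and `y`, with a basis given by powers of the principal symbol of `z`. -/
theorem bijective_gr_free (ha : 0 < a.natDegree) :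
    letI := grCommRing α (ne_zero_of_natDegree_gt ha)
    Function.Bijective fun P : Fin a.natDegree → MvPolynomial (Fin 2) k =>
      ∑ i, MvPolynomial.aeval ![grGen (a := a) α 0, grGen α 1] (P i) * grGen α 2 ^ (i : ℕ) := by
  let := grCommRing α (ne_zero_of_natDegree_gt ha)
  refine ⟨fun P Q hPQ => funext fun i₀ => MvPolynomial.ext _ _ fun s₀ => ?_,
    surjective_gr_free α ha⟩
  have hf := laurentFunctional_filtLT (a := a) α
    (m := s₀ 0 * a.natDegree + (s₀ 1 * a.natDegree + i₀ * 2))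
    (j := (s₀ 0 : ℤ) - s₀ 1) (d := a.natDegree * s₀ 1 + i₀) (by push_cast; linarith)
  have key : ∀ (i : Fin a.natDegree) (p : MvPolynomial (Fin 2) k),
      grFunctional _ _ hf (MvPolynomial.aeval ![grGen (a := a) α 0, grGen α 1] p *
        grGen α 2 ^ (i : ℕ)) = if i = i₀ then p.coeff s₀ * a.leadingCoeff ^ s₀ 1 else 0 := by
    intro i p
    induction p using MvPolynomial.induction_on' with
    | add p q hp hq =>
      rw [map_add, add_mul, map_add, hp, hq, MvPolynomial.coeff_add]
      split_ifs
      · ring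
      · rw [add_zero]
    | monomial s c =>
      rw [MvPolynomial.aeval_monomial, Finsupp.prod_fintype _ _ (fun _ => pow_zero _),
        Fin.prod_univ_two, ← Algebra.smul_def, smul_mul_assoc, map_smul, mul_assoc]
      refine (congrArg (c • ·) (grFunctional_monomial α i₀.2 i.2 hf)).trans ?_
      rw [MvPolynomial.coeff_monomial]
      have hs : s = s₀ ↔ s 0 = s₀ 0 ∧ s 1 = s₀ 1 := by
        rw [Finsupp.ext_iff, Fin.forall_fin_two]
      simp only [hs, ← Fin.ext_iff]
      by_cases h1 : i = i₀ <;> by_cases h2 : s 0 = s₀ 0 ∧ s 1 = s₀ 1 <;> simp [h1, h2]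
  have h := congrArg (grFunctional _ _ hf) hPQ
  simp only [map_sum, key, Finset.sum_ite_eq', Finset.mem_univ, if_true] at h
  exact mul_right_cancel₀ (pow_ne_zero _ (leadingCoeff_ne_zero.2 (ne_zero_of_natDegree_gt ha))) h

theorem grGen_pow_mem (ha : 0 < a.natDegree) :
    letI := grCommRing α (ne_zero_of_natDegree_gt ha)
    grGen (a := a) α 2 ^ a.natDegree ∈ Ideal.span {grGen (a := a) α 0, grGen α 1} := by
  let := grCommRing α (ne_zero_of_natDegree_gt ha)
  have hc : a.leadingCoeff ≠ 0 := leadingCoeff_ne_zero.2 (ne_zero_of_natDegree_gt ha)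
  have h : grGen (a := a) α 2 ^ a.natDegree =
      algebraMap k _ a.leadingCoeff⁻¹ * grGen α 0 * grGen α 1 := by
    rw [mul_assoc, grGen_zero_mul_one, ← Algebra.smul_def, smul_smul, inv_mul_cancel₀ hc, one_smul]
  rw [h]
  exact Ideal.mul_mem_left _ _ (Ideal.subset_span (by simp))

end ClassicalGWA

end GradedGWA

/-! ### Filtered automorphisms of classical generalized Weyl algebras -/

section FilteredAutomorphisms

universe u

namespace ClassicalGWA

variable {k : Type u} [Field k] (α : k) {a : k[X]}

theorem length_le_sum_genDeg (ha : 0 < a.natDegree) (w : List (Fin 3)) :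
    w.length ≤ (w.map (genDeg a)).sum := by
  induction w with
  | nil => simp
  | cons g w ih =>
    have : 0 < genDeg a g := by fin_cases g <;> simp [genDeg, ha]
    simp only [List.length_cons, List.map_cons, List.sum_cons]
    omega

theorem prod_gen_cases (ha : 0 < a.natDegree) {w : List (Fin 3)}
    (hw : (w.map (genDeg a)).sum ≤ a.natDegree) :
    w = [0] ∨ w = [1] ∨ w = List.replicate w.length 2 := by
  by_cases h : ∃ g ∈ w, g ≠ 2
  · obtain ⟨g, hg, hg2⟩ := h
    obtain ⟨w₁, w₂, rfl⟩ := List.append_of_mem hg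
    have hd : genDeg a g = a.natDegree := by
      fin_cases g
      · rfl
      · rfl
      · exact absurd rfl hg2
    have h1 := length_le_sum_genDeg ha w₁
    have h2 := length_le_sum_genDeg ha w₂
    simp only [List.map_append, List.map_cons, List.sum_append, List.sum_cons, hd] at hw
    obtain rfl : w₁ = [] := List.length_eq_zero_iff.1 (by omega)
    obtain rfl : w₂ = [] := List.length_eq_zero_iff.1 (by omega)
    fin_cases g
    · exact Or.inl rfl
    · exact Or.inr (Or.inl rfl)
    · exact absurd rfl hg2
  · push Not at h
    exact Or.inr (Or.inr (List.eq_replicate_iff.2 ⟨rfl, h⟩))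

theorem prod_gen_replicate (m : ℕ) :
    ((List.replicate m 2).map (gen α a)).prod = GWA.coeff (shiftAut α) a (X ^ m) := by
  rw [List.map_replicate, List.prod_replicate, map_pow]
  rfl

theorem exists_of_mem_stdFiltration_natDegree (ha : 0 < a.natDegree) {r : ClassicalGWA α a}
    (hr : r ∈ stdFiltration α a a.natDegree) : ∃ (p q : k) (h : k[X]),
      r = p • GWA.x (shiftAut α) a + q • GWA.y (shiftAut α) a + GWA.coeff (shiftAut α) a h := by
  induction hr using Submodule.span_induction with
  | zero => exact ⟨0, 0, 0, by simp⟩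
  | add r s _ _ hr hs =>
    obtain ⟨p, q, h, rfl⟩ := hr
    obtain ⟨p', q', h', rfl⟩ := hs
    exact ⟨p + p', q + q', h + h', by rw [map_add]; module⟩
  | smul c r _ hr =>
    obtain ⟨p, q, h, rfl⟩ := hr
    exact ⟨c * p, c * q, c • h, by rw [map_smul]; module⟩
  | mem r hr =>
    obtain ⟨w, hw, rfl⟩ := hr
    rcases prod_gen_cases ha hw with rfl | rfl | hw'
    · exact ⟨1, 0, 0, by simp [gen]⟩
    · exact ⟨0, 1, 0, by simp [gen]⟩
    · rw [hw', prod_gen_replicate]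
      exact ⟨0, 0, _, by rw [zero_smul, zero_smul, zero_add, zero_add]⟩

theorem exists_of_mem_stdFiltration_two (ha : 2 < a.natDegree) {r : ClassicalGWA α a}
    (hr : r ∈ stdFiltration α a 2) : ∃ e f : k,
      r = GWA.coeff (shiftAut α) a (C e * X + C f) := by
  induction hr using Submodule.span_induction with
  | zero => exact ⟨0, 0, by simp⟩
  | add r s _ _ hr hs =>
    obtain ⟨e, f, rfl⟩ := hr
    obtain ⟨e', f', rfl⟩ := hs
    refine ⟨e + e', f + f', ?_⟩
    rw [← map_add, map_add C, map_add C]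
    congr 1
    ring
  | smul c r _ hr =>
    obtain ⟨e, f, rfl⟩ := hr
    refine ⟨c * e, c * f, ?_⟩
    rw [← map_smul, smul_eq_C_mul, map_mul C, map_mul C]
    congr 1
    ring
  | mem r hr =>
    obtain ⟨w, hw, rfl⟩ := hr
    have hd : ∀ g, genDeg a g ≠ 2 → genDeg a g = a.natDegree := by
      intro g hg
      fin_cases g
      · rfl
      · rfl
      · exact absurd rfl hg
    rcases prod_gen_cases (by omega) (hw.trans ha.le) with rfl | rfl | hw'
    · simp [genDeg] at hw; omega
    · simp [genDeg] at hw; omega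
    · rw [hw'] at hw ⊢
      rw [prod_gen_replicate]
      have : w.length * 2 ≤ 2 := by
        simpa [genDeg, List.map_replicate, List.sum_replicate] using hw
      rcases (by omega : w.length = 0 ∨ w.length = 1) with h | h <;> rw [h]
      · exact ⟨0, 1, by simp⟩
      · exact ⟨1, 0, by simp⟩

theorem coeff_injective : Function.Injective (GWA.coeff (shiftAut α) a) := fun p q h => by
  have := congrArg (GWA.laurentCoeff (shiftAut α) a) h
  rw [GWA.laurentCoeff_coeff, GWA.laurentCoeff_coeff] at this
  simpa using congrFun this 0

theorem combination_eq_zero (ha : a ≠ 0) {p q : k} {h : k[X]}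
    (hr : p • GWA.x (shiftAut α) a + q • GWA.y (shiftAut α) a + GWA.coeff (shiftAut α) a h = 0) :
    p = 0 ∧ q = 0 ∧ h = 0 := by
  have key := congrArg (GWA.laurentCoeff (shiftAut α) a) hr
  rw [map_add, map_add, map_smul, map_smul, GWA.laurentCoeff_x, GWA.laurentCoeff_y,
    GWA.laurentCoeff_coeff, map_zero] at key
  refine ⟨?_, ?_, ?_⟩
  · simpa using congrFun key 1
  · simpa [ha] using congrFun key (-1)
  · simpa using congrFun key 0

theorem x_commutator : GWA.x (shiftAut α) a * GWA.coeff (shiftAut α) a X -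
    GWA.coeff (shiftAut α) a X * GWA.x (shiftAut α) a = -α • GWA.x (shiftAut α) a := by
  rw [GWA.x_mul_coeff, shiftAut_apply, taylor_X, map_add, add_mul, add_sub_cancel_left,
    ← algebraMap_eq, AlgHom.commutes, ← Algebra.smul_def]

theorem y_commutator : GWA.y (shiftAut α) a * GWA.coeff (shiftAut α) a X -
    GWA.coeff (shiftAut α) a X * GWA.y (shiftAut α) a = α • GWA.y (shiftAut α) a := by
  rw [GWA.y_mul_coeff, shiftAut_symm_apply, taylor_X, map_add, add_mul, add_sub_cancel_left,
    ← algebraMap_eq, AlgHom.commutes, ← Algebra.smul_def]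

theorem eigen_combination (ha : a ≠ 0) {p q e f c : k} {h : k[X]} {r : ClassicalGWA α a}
    (hr : r = p • GWA.x (shiftAut α) a + q • GWA.y (shiftAut α) a + GWA.coeff (shiftAut α) a h)
    (hc : r * GWA.coeff (shiftAut α) a (C e * X + C f) -
      GWA.coeff (shiftAut α) a (C e * X + C f) * r = c • r) :
    (c + e * α) * p = 0 ∧ (c - e * α) * q = 0 ∧ c • h = 0 := by
  refine combination_eq_zero α ha ?_
  have h1 : r * GWA.coeff (shiftAut α) a (C e * X + C f) -
      GWA.coeff (shiftAut α) a (C e * X + C f) * r =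
        e • (r * GWA.coeff (shiftAut α) a X - GWA.coeff (shiftAut α) a X * r) := by
    rw [map_add, ← algebraMap_eq, AlgHom.commutes, algebraMap_eq, ← smul_eq_C_mul, map_smul,
      mul_add, add_mul, Algebra.commutes, mul_smul_comm, smul_mul_assoc, smul_sub]
    abel
  have h2 : r * GWA.coeff (shiftAut α) a X - GWA.coeff (shiftAut α) a X * r =
      p • (-α • GWA.x (shiftAut α) a) + q • (α • GWA.y (shiftAut α) a) := by
    rw [← x_commutator, ← y_commutator, hr]
    simp only [add_mul, mul_add, smul_mul_assoc, mul_smul_comm, smul_sub, ← map_mul,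
      mul_comm X h]
    abel
  rw [h1, h2, hr] at hc
  rw [map_smul]
  have h3 := sub_eq_zero.2 hc
  rw [← neg_eq_zero, ← h3]
  module

theorem eq_zero_of_taylor_eq [CharZero k] (ha : 0 < a.natDegree) {f : k} (h : taylor f a = a) :
    f = 0 := by
  by_contra hf
  have h1 : ∀ m : ℕ, a.eval (m * f) = a.eval 0 := by
    intro m
    induction m with
    | zero => simp
    | succ m ih =>
      rw [← ih]
      nth_rewrite 2 [← h]
      rw [taylor_eval]
      congr 1
      push_cast
      ring
  have h2 : a - C (a.eval 0) = 0 := by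
    refine eq_zero_of_infinite_isRoot _ (Set.infinite_of_injective_forall_mem
      (f := fun m : ℕ => (m : k) * f) (fun m l hml => ?_) fun m => ?_)
    · exact_mod_cast mul_right_cancel₀ hf hml
    · simp [IsRoot, h1]
  rw [sub_eq_zero.1 h2, natDegree_C] at ha
  exact ha.false

theorem isReflection_unique [CharZero k] (ha : 0 < a.natDegree) {ρ ρ' : k}
    (h : IsReflection a ρ) (h' : IsReflection a ρ') : ρ = ρ' := by
  have h1 : a.comp (C ρ - X) = a.comp (C ρ' - X) := by rw [h, h']
  have h2 := congrArg (fun p => p.comp (C ρ' - X)) h1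
  simp only [comp_assoc, sub_comp, C_comp, X_comp] at h2
  rw [sub_sub_cancel, comp_X, show C ρ - (C ρ' - X) = X + C (ρ - ρ') by rw [map_sub]; ring] at h2
  exact sub_eq_zero.1 (eq_zero_of_taylor_eq ha h2)

theorem map_coeff_eq_comp (g : ClassicalGWA α a ≃ₐ[k] ClassicalGWA α a) {q : k[X]}
    (hg : g (GWA.coeff (shiftAut α) a X) = GWA.coeff (shiftAut α) a q) (d : k[X]) :
    g (GWA.coeff (shiftAut α) a d) = GWA.coeff (shiftAut α) a (d.comp q) := by
  have : (g : ClassicalGWA α a →ₐ[k] ClassicalGWA α a).comp (GWA.coeff (shiftAut α) a) =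
      (GWA.coeff (shiftAut α) a).comp (aeval q) := Polynomial.algHom_ext (by simpa using hg)
  exact (DFunLike.congr_fun this d).trans (by simp [comp_eq_aeval])

theorem algEquiv_ext {g g' : ClassicalGWA α a ≃ₐ[k] ClassicalGWA α a}
    (hz : g (GWA.coeff (shiftAut α) a X) = g' (GWA.coeff (shiftAut α) a X))
    (hx : g (GWA.x (shiftAut α) a) = g' (GWA.x (shiftAut α) a))
    (hy : g (GWA.y (shiftAut α) a) = g' (GWA.y (shiftAut α) a)) : g = g' := by
  have : (g : ClassicalGWA α a →ₐ[k] ClassicalGWA α a) = g' := by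
    refine GWA.algHom_ext (fun d => ?_) hx hy
    have : (g : ClassicalGWA α a →ₐ[k] ClassicalGWA α a).comp (GWA.coeff (shiftAut α) a) =
        (g' : ClassicalGWA α a →ₐ[k] ClassicalGWA α a).comp (GWA.coeff (shiftAut α) a) :=
      Polynomial.algHom_ext hz
    exact DFunLike.congr_fun this d
  exact AlgEquiv.ext fun r => DFunLike.congr_fun this r

theorem Theta_x (c : kˣ) : GWA.Theta (shiftAut α) a c (GWA.x (shiftAut α) a) =
    (c : k) • GWA.x (shiftAut α) a := by
  simp [GWA.Theta, GWA.ThetaHom]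

theorem Theta_y (c : kˣ) : GWA.Theta (shiftAut α) a c (GWA.y (shiftAut α) a) =
    (c⁻¹ : k) • GWA.y (shiftAut α) a := by
  simp [GWA.Theta, GWA.ThetaHom]

theorem Theta_coeff (c : kˣ) (d : k[X]) :
    GWA.Theta (shiftAut α) a c (GWA.coeff (shiftAut α) a d) = GWA.coeff (shiftAut α) a d := by
  simp [GWA.Theta, GWA.ThetaHom]

/-- An automorphism of degree zero is a map `Θ_c`, or the product of `Ω` and such a map. -/
theorem filteredAut_cases [CharZero k] (hα : α ≠ 0) (ha : 2 < a.natDegree)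
    {g : ClassicalGWA α a ≃ₐ[k] ClassicalGWA α a} (hg : g ∈ filteredAut (stdFiltration α a)) :
    (∃ c : kˣ, g = GWA.Theta (shiftAut α) a c) ∨
      ∃ (ρ : k) (hρ : IsReflection a ρ) (c : kˣ),
        g = Omega α hρ * GWA.Theta (shiftAut α) a c := by
  have ha0 : 0 < a.natDegree := by omega
  have hane : a ≠ 0 := ne_zero_of_natDegree_gt ha
  obtain ⟨e, f, hz⟩ := exists_of_mem_stdFiltration_two α ha
    ((hg 2 _).2 (gen_mem_stdFiltration α a 2))
  obtain ⟨p, q, h, hx⟩ := exists_of_mem_stdFiltration_natDegree α ha0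
    ((hg _ _).2 (gen_mem_stdFiltration α a 0))
  obtain ⟨p', q', h', hy⟩ := exists_of_mem_stdFiltration_natDegree α ha0
    ((hg _ _).2 (gen_mem_stdFiltration α a 1))
  change g (GWA.coeff (shiftAut α) a X) = _ at hz
  change g (GWA.x (shiftAut α) a) = _ at hx
  change g (GWA.y (shiftAut α) a) = _ at hy
  have hcx := congrArg g (x_commutator (a := a) α)
  have hcy := congrArg g (y_commutator (a := a) α)
  rw [map_sub, map_mul, map_mul, map_smul, hz] at hcx hcy
  obtain ⟨h1, h2, h3⟩ := eigen_combination α hane hx hcx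
  obtain ⟨h1', h2', h3'⟩ := eigen_combination α hane hy hcy
  obtain rfl : h = 0 := by simpa [hα] using h3
  obtain rfl : h' = 0 := by simpa [hα] using h3'
  rw [show -α + e * α = (e - 1) * α by ring, mul_assoc, mul_eq_zero, mul_eq_zero] at h1
  rw [show -α - e * α = (e + 1) * -α by ring, mul_assoc, mul_eq_zero, mul_eq_zero] at h2
  rw [show α + e * α = (e + 1) * α by ring, mul_assoc, mul_eq_zero, mul_eq_zero] at h1'
  rw [show α - e * α = (e - 1) * -α by ring, mul_assoc, mul_eq_zero, mul_eq_zero] at h2'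
  simp only [hα, neg_eq_zero, false_or] at h1 h2 h1' h2'
  have hgx : p ≠ 0 ∨ q ≠ 0 := by
    by_contra! hpq
    rw [hpq.1, hpq.2] at hx
    have h0 : GWA.x (shiftAut α) a = 0 := by
      refine g.injective ?_
      rw [hx]
      simp
    have := (combination_eq_zero α hane (p := 1) (q := 0) (h := 0) (by simpa using h0)).1
    exact one_ne_zero this
  have hyx := congrArg g (GWA.y_mul_x (shiftAut α) a)
  rw [map_mul, map_coeff_eq_comp α g hz] at hyx
  by_cases he : e = 1
  · subst he
    have h11 : (1 : k) + 1 ≠ 0 := by norm_num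
    obtain rfl : q = 0 := h2.resolve_left h11
    obtain rfl : p' = 0 := h1'.resolve_left h11
    simp only [zero_smul, map_zero, add_zero, zero_add, ne_eq, not_true, or_false] at hx hy hgx
    rw [hx, hy, smul_mul_smul_comm, GWA.y_mul_x, ← map_smul, map_one, one_mul] at hyx
    have h4 : (q' * p) • a = taylor f a := coeff_injective α hyx
    have h5 : q' * p = 1 := by
      have := congrArg leadingCoeff h4
      rw [leadingCoeff_taylor, smul_eq_C_mul, leadingCoeff_mul, leadingCoeff_C] at this
      exact mul_right_cancel₀ (leadingCoeff_ne_zero.2 hane) (this.trans (one_mul _).symm)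
    rw [h5, one_smul] at h4
    obtain rfl : f = 0 := eq_zero_of_taylor_eq ha0 h4.symm
    refine Or.inl ⟨Units.mk0 p hgx, algEquiv_ext α ?_ ?_ ?_⟩
    · rw [hz, Theta_coeff]; simp
    · rw [hx, Theta_x]; rfl
    · rw [hy, Theta_y, eq_inv_of_mul_eq_one_left h5]; rfl
  · have he' : e - 1 ≠ 0 := sub_ne_zero.2 he
    obtain rfl : p = 0 := h1.resolve_left he'
    obtain rfl : q' = 0 := h2'.resolve_left he'
    simp only [zero_smul, map_zero, add_zero, zero_add, ne_eq, not_true, false_or] at hx hy hgx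
    obtain rfl : e = -1 := eq_neg_of_add_eq_zero_left (h2.resolve_right hgx)
    rw [hx, hy, smul_mul_smul_comm, GWA.x_mul_y, ← map_smul, shiftAut_apply, map_neg, map_one,
      neg_one_mul, neg_add_eq_sub] at hyx
    have h4 : (p' * q) • taylor (-α) a = a.comp (C f - X) := coeff_injective α hyx
    have h5 : p' * q = (-1) ^ a.natDegree := by
      have hd : (C f - X : k[X]).natDegree = 1 := by
        rw [← neg_sub, natDegree_neg, natDegree_X_sub_C]
      have hl : (C f - X : k[X]).leadingCoeff = -1 := by
        rw [← neg_sub, leadingCoeff_neg, leadingCoeff_X_sub_C]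
      have := congrArg leadingCoeff h4
      rw [leadingCoeff_comp (by omega), hl, smul_eq_C_mul, leadingCoeff_mul, leadingCoeff_C,
        leadingCoeff_taylor, mul_comm] at this
      exact mul_left_cancel₀ (leadingCoeff_ne_zero.2 hane) this
    have hρ : IsReflection a (f - α) := by
      have := congrArg (taylor α) h4
      rw [map_smul, taylor_taylor, add_neg_cancel, taylor_zero, h5, taylor_apply, comp_assoc] at this
      rw [IsReflection, show C (f - α) - X = (C f - X).comp (X + C α) by
        simp only [sub_comp, C_comp, X_comp, map_sub]; ring, ← this, smul_eq_C_mul]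
      simp
    refine Or.inr ⟨f - α, hρ, Units.mk0 q hgx, algEquiv_ext α ?_ ?_ ?_⟩
    · rw [hz, AlgEquiv.mul_apply, Theta_coeff, Omega_z]
      congr 1
      rw [add_sub_cancel, map_neg, map_one]
      ring
    · rw [hx, AlgEquiv.mul_apply, Theta_x, map_smul, Omega_x]; rfl
    · rw [hy, AlgEquiv.mul_apply, Theta_y, map_smul, Omega_y, smul_smul, ← h5, mul_comm p',
        Units.val_mk0, inv_mul_cancel_left₀ hgx]

theorem map_mem_stdFiltration {f : ClassicalGWA α a →ₐ[k] ClassicalGWA α a}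
    (hf : ∀ g, f (gen α a g) ∈ stdFiltration α a (genDeg a g)) {m : ℕ} {r : ClassicalGWA α a}
    (hr : r ∈ stdFiltration α a m) : f r ∈ stdFiltration α a m := by
  induction hr using Submodule.span_induction with
  | zero => rw [map_zero]; exact zero_mem _
  | add r s _ _ hr hs => rw [map_add]; exact add_mem hr hs
  | smul c r _ hr => rw [map_smul]; exact Submodule.smul_mem _ _ hr
  | mem r hr =>
    obtain ⟨w, hw, rfl⟩ := hr
    rw [map_list_prod, List.map_map]
    have := (grSymbol_list_prod (genDeg a) (fun g => f (gen α a g)) hf w).2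
    exact IsFiltration.mono (F := stdFiltration α a) hw this

theorem mem_filteredAut {g : ClassicalGWA α a ≃ₐ[k] ClassicalGWA α a}
    (hg : ∀ i, g (gen α a i) ∈ stdFiltration α a (genDeg a i))
    (hg' : ∀ i, g.symm (gen α a i) ∈ stdFiltration α a (genDeg a i)) :
    g ∈ filteredAut (stdFiltration α a) := by
  refine fun m r => ⟨fun hr => ?_, fun hr => ?_⟩
  · have := map_mem_stdFiltration α (f := g.symm.toAlgHom) hg' hr
    rwa [show g.symm.toAlgHom (g r) = r from g.symm_apply_apply r] at this
  · exact map_mem_stdFiltration α (f := g.toAlgHom) hg hr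

theorem Theta_gen_mem (c : kˣ) (i : Fin 3) :
    GWA.ThetaHom (shiftAut α) a c (gen α a i) ∈ stdFiltration α a (genDeg a i) := by
  fin_cases i
  · change GWA.ThetaHom (shiftAut α) a c (GWA.x (shiftAut α) a) ∈ stdFiltration α a a.natDegree
    rw [GWA.ThetaHom, GWA.lift_x]
    exact Submodule.smul_mem _ _ (gen_mem_stdFiltration α a 0)
  · change GWA.ThetaHom (shiftAut α) a c (GWA.y (shiftAut α) a) ∈ stdFiltration α a a.natDegree
    rw [GWA.ThetaHom, GWA.lift_y]
    exact Submodule.smul_mem _ _ (gen_mem_stdFiltration α a 1)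
  · change GWA.ThetaHom (shiftAut α) a c (GWA.coeff (shiftAut α) a X) ∈ stdFiltration α a 2
    rw [GWA.ThetaHom, GWA.lift_coeff]
    exact gen_mem_stdFiltration α a 2

theorem Theta_mem_filteredAut (c : kˣ) :
    GWA.Theta (shiftAut α) a c ∈ filteredAut (stdFiltration α a) :=
  mem_filteredAut α (Theta_gen_mem α c) (Theta_gen_mem α c⁻¹)

theorem OmegaHom_gen_mem {ρ : k} (hρ : IsReflection a ρ) (c e : k)
    (h : c * e = (-1) ^ a.natDegree) (i : Fin 3) :
    OmegaHom α hρ c e h (gen α a i) ∈ stdFiltration α a (genDeg a i) := by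
  fin_cases i
  · change OmegaHom α hρ c e h (GWA.x (shiftAut α) a) ∈ stdFiltration α a a.natDegree
    rw [OmegaHom, GWA.lift_x]
    exact Submodule.smul_mem _ _ (gen_mem_stdFiltration α a 1)
  · change OmegaHom α hρ c e h (GWA.y (shiftAut α) a) ∈ stdFiltration α a a.natDegree
    rw [OmegaHom, GWA.lift_y]
    exact Submodule.smul_mem _ _ (gen_mem_stdFiltration α a 0)
  · change OmegaHom α hρ c e h (GWA.coeff (shiftAut α) a X) ∈ stdFiltration α a 2
    rw [OmegaHom, GWA.lift_coeff]
    refine coeff_mem_stdFiltration α a (p := flipHom α ρ X) ?_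
    rw [flipHom, aeval_X, ← neg_sub, natDegree_neg, natDegree_X_sub_C]

theorem Omega_mem_filteredAut {ρ : k} (hρ : IsReflection a ρ) :
    Omega α hρ ∈ filteredAut (stdFiltration α a) :=
  mem_filteredAut α (OmegaHom_gen_mem α hρ _ _ _) (OmegaHom_gen_mem α hρ _ _ _)

theorem isFilteredHdet_one [IsAlgClosed k] [CharZero k] (hα : α ≠ 0) (ha : 2 < a.natDegree)
    (g : filteredAut (stdFiltration α a)) : IsFilteredHdet (stdFiltration α a) g 1 := by
  have ha0 : 0 < a.natDegree := by omega
  let := grCommRing α (ne_zero_of_natDegree_gt ha0)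
  have hgen := gen_mem_stdFiltration α a
  have hgr : ∀ i, grAut g (grGen α i) = grSymbol _ (genDeg a i)
      ((g : ClassicalGWA α a ≃ₐ[k] ClassicalGWA α a) (gen α a i)) :=
    fun i => grAut_grSymbol g (hgen i)
  rcases filteredAut_cases α hα ha g.2 with ⟨c, hc⟩ | ⟨ρ, hρ, c, hc⟩
  · refine isHdet_one_of_diagonal ha0 (bijective_gr_free α ha0) (grGen_pow_mem α ha0) (grAut g)
      (grIrrelevant_eq α ha0) _ (p := c) (r := (c : k)⁻¹) (by simp) ?_ ?_ ?_
    · refine (hgr 0).trans (Eq.trans ?_ (grSymbol_smul _ (hgen 0)))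
      rw [hc]
      exact congrArg _ (Theta_x α c)
    · refine (hgr 1).trans (Eq.trans ?_ (grSymbol_smul _ (hgen 1)))
      rw [hc]
      exact congrArg _ (Theta_y α c)
    · refine (hgr 2).trans ?_
      rw [hc]
      exact congrArg _ (Theta_coeff α c X)
  · have hx : GWA.x _ a ∈ stdFiltration α a a.natDegree := gen_mem_stdFiltration α a 0
    have hy : GWA.y _ a ∈ stdFiltration α a a.natDegree := gen_mem_stdFiltration α a 1
    refine isHdet_one_of_antidiagonal two_ne_zero ha0 (bijective_gr_free α ha0)
      (grGen_pow_mem α ha0) (grAut g) (grIrrelevant_eq α ha0) _ (q := c)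
      (r := (c : k)⁻¹ * (-1) ^ a.natDegree) (by simp) ?_ ?_ ?_
    · refine (hgr 0).trans (Eq.trans ?_ (grSymbol_smul _ hy))
      rw [hc]
      refine congrArg _ ((congrArg (Omega α hρ) (Theta_x α c)).trans ?_)
      rw [map_smul, Omega_x]
      rfl
    · refine (hgr 1).trans (Eq.trans ?_ (grSymbol_smul _ hx))
      rw [hc]
      refine congrArg _ ((congrArg (Omega α hρ) (Theta_y α c)).trans ?_)
      rw [map_smul, Omega_y, smul_smul]
      rfl
    · refine (hgr 2).trans ?_
      rw [hc]
      refine (congrArg _ ((congrArg (Omega α hρ) (Theta_coeff α c X)).trans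
        (Omega_z α hρ))).trans ?_
      refine (grSymbol_coeff α (i := 1) ?_).trans ?_
      · rw [← neg_sub, natDegree_neg, natDegree_X_sub_C]
      · simp

end ClassicalGWA

end FilteredAutomorphisms

theorem mainTheorem4 {k : Type*} [Field k] [IsAlgClosed k] [CharZero k] (α : k) (hα : α ≠ 0)
    (a : k[X]) (ha : 2 < a.natDegree) :
    (¬ ClassicalGWA.IsReflective a →
      filteredAut (ClassicalGWA.stdFiltration α a) = Subgroup.closure (Set.range (GWA.Theta (shiftAut α) a))) ∧
    (∀ (ρ : k) (hρ : ClassicalGWA.IsReflection a ρ),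
      filteredAut (ClassicalGWA.stdFiltration α a) =
        Subgroup.closure (insert (ClassicalGWA.Omega α hρ) (Set.range (GWA.Theta (shiftAut α) a)))) ∧
    ∀ g : filteredAut (ClassicalGWA.stdFiltration α a), IsFilteredHdet (ClassicalGWA.stdFiltration α a) g 1 := by
  refine ⟨fun h => le_antisymm (fun g hg => ?_) ((Subgroup.closure_le _).2 ?_),
    fun ρ hρ => le_antisymm (fun g hg => ?_) ((Subgroup.closure_le _).2 ?_),
    ClassicalGWA.isFilteredHdet_one α hα ha⟩
  · rcases ClassicalGWA.filteredAut_cases α hα ha hg with ⟨c, rfl⟩ | ⟨ρ, hρ, -⟩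
    · exact Subgroup.subset_closure ⟨c, rfl⟩
    · exact absurd ⟨ρ, hρ⟩ h
  · rintro _ ⟨c, rfl⟩
    exact ClassicalGWA.Theta_mem_filteredAut α c
  · rcases ClassicalGWA.filteredAut_cases α hα ha hg with ⟨c, rfl⟩ | ⟨ρ', hρ', c, rfl⟩
    · exact Subgroup.subset_closure (Set.mem_insert_of_mem _ ⟨c, rfl⟩)
    · obtain rfl := ClassicalGWA.isReflection_unique (by omega) hρ hρ'
      exact mul_mem (Subgroup.subset_closure (Set.mem_insert _ _))
        (Subgroup.subset_closure (Set.mem_insert_of_mem _ ⟨c, rfl⟩))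
  · rintro _ (rfl | ⟨c, rfl⟩)
    · exact ClassicalGWA.Omega_mem_filteredAut α hρ
    · exact ClassicalGWA.Theta_mem_filteredAut α c
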